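/- \textbf{Definitions.} A signed graph has, for each pair of (possibly equal) vertices, at most one positive (blue) and at most one negative (red) edge. An edge is \emph{bicoloured} if both signs are present between its ends and \emph{unicoloured} if exactly one is. A signed graph is \emph{irreflexive} if it has no loops, and \emph{uni-balanced} if every cycle of unicoloured edges has an even number of red edges. \emph{Switching} at a vertex negates the signs of all non-loop edges at it. A \emph{homomorphism} $\widehat G\to\widehat H$ is a map $f:V(G)\to V(H)$ such that, for some $\widehat G'$ obtained from $\widehat G$ by a sequence of switchings, $f$ maps every positive edge of $\widehat G'$ to a pair joined by a positive edge of $\widehat H$, and every negative edge of $\widehat G'$ to a pair joined by a negative edge of $\widehat H$. For a fixed finite $\widehat H$, the problem \textsc{List-S-Hom}$(\widehat H)$ takes as input a finite signed graph $\widehat G$ with lists $L(v)\subseteq V(H)$, $v\in V(G)$, and asks whether there is a homomorphism $f:\widehat G\to\widehat H$ with $f(v)\in L(v)$ for all $v$ (a \emph{list homomorphism}). A \emph{special bipartite min ordering} of $\widehat H$ consists of a bipartition of the underlying graph of $\widehat H$ into black and white vertices, together with a linear ordering $<_b$ of the black vertices and a linear ordering $<_w$ of the white vertices, such that (i) if $x<_w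 x'$ and $y<_b y'$ and $xy'$, $x'y$ are edges, then $xy$ is an edge; (ii) the bicoloured neighbours of each vertex precede its unicoloured neighbours. \textbf{Theorem.} Let $\widehat H$ be a finite uni-balanced irreflexive signed graph whose unicoloured edges form a connected spanning subgraph. Suppose that $\widehat H$ has a special bipartite min ordering. Then \textsc{List-S-Hom}$(\widehat H)$ is solvable in polynomial time (by a Turing machine, in the size of the input). Moreover, for every special bipartite min ordering of $\widehat H$, the following test is correct on every input $(\widehat G,L)$ in which each list consists of black vertices only or of white vertices only. Run the arc consistency test for the underlying graphs, i.e., for as long as possible remove from a list $L(v)$ any vertex that, for some edge $vu$ of $G$, has no neighbour in $L(u)$; at most $|V(G)|\cdot|V(H)|$ rounds of this are needed. Then a list homomorphism $\widehat G\to\widehat H$ exists if and only if all the remaining lists are non-empty and choosing the minimum element of each remaining list is a list homomorphism $\widehat G\to\widehat H$. -/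

import Mathlib

/-- A signed graph on the vertex set `V`, loops allowed. For each pair of (possibly equal) vertices
there is at most one positive (blue) and at most one negative (red) edge:
`pos u v` says that `uv` is at least positive, `neg u v` that it is at least negative. -/
@[ext]
structure SignedGraph (V : Type) where
  pos : V → V → Prop
  neg : V → V → Prop
  pos_symm : ∀ u v, pos u v → pos v u
  neg_symm : ∀ u v, neg u v → neg v u

namespace SignedGraph

variable {V W : Type}

/-- Adjacency in the underlying graph. -/
def Adj (A : SignedGraph V) (u v : V) : Prop := A.pos u v ∨ A.neg u v

/-- `uv` is a bicoloured edge (or loop): a red-blue pair. -/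
def Bicoloured (A : SignedGraph V) (u v : V) : Prop := A.pos u v ∧ A.neg u v

/-- `uv` is a unicoloured edge (or loop), i.e. unicoloured blue or unicoloured red. -/
def Unicoloured (A : SignedGraph V) (u v : V) : Prop := A.Adj u v ∧ ¬ A.Bicoloured u v

/-- No vertex has a loop. -/
def Irreflexive (A : SignedGraph V) : Prop := ∀ v, ¬ A.Adj v v

/-- The spanning subgraph formed by all unicoloured non-loop edges. -/
def uniGraph (A : SignedGraph V) : SimpleGraph V where
  Adj u v := u ≠ v ∧ A.Unicoloured u v
  symm := ⟨fun u v h => by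
    obtain ⟨hne, hadj, hbi⟩ := h
    refine ⟨hne.symm, ?_, fun hb => hbi ⟨A.pos_symm _ _ hb.1, A.neg_symm _ _ hb.2⟩⟩
    exact hadj.imp (A.pos_symm _ _) (A.neg_symm _ _)⟩
  loopless := ⟨fun _ h => h.1 rfl⟩

open Classical in
/-- The number of red edges on a walk of unicoloured edges. -/
noncomputable def redCount (A : SignedGraph V) {u v : V} (p : A.uniGraph.Walk u v) : ℕ :=
  p.darts.countP (fun d => decide (A.neg d.fst d.snd))

/-- Every cycle of unicoloured edges has an even number of red edges; a unicoloured loop is a cycle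
with one edge, so it must not be red. -/
def UniBalanced (A : SignedGraph V) : Prop :=
  (∀ (v : V) (p : A.uniGraph.Walk v v), p.IsCycle → Even (A.redCount p)) ∧
    ∀ v, A.Unicoloured v v → ¬ A.neg v v

/-- Switching at the vertex `w`: the signs of all non-loop edges at `w` are negated. -/
def switchAt (A : SignedGraph V) (w : V) : SignedGraph V where
  pos u v := (Xor (u = w) (v = w) ∧ A.neg u v) ∨ (¬ Xor (u = w) (v = w) ∧ A.pos u v)
  neg u v := (Xor (u = w) (v = w) ∧ A.pos u v) ∨ (¬ Xor (u = w) (v = w) ∧ A.neg u v)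
  pos_symm u v h := by
    rw [xor_comm (v = w)]
    exact h.imp (And.imp_right (A.neg_symm _ _)) (And.imp_right (A.pos_symm _ _))
  neg_symm u v h := by
    rw [xor_comm (v = w)]
    exact h.imp (And.imp_right (A.pos_symm _ _)) (And.imp_right (A.neg_symm _ _))

/-- `B` is obtained from `A` by a finite sequence of switchings. -/
def SwitchingEquivalent (A B : SignedGraph V) : Prop :=
  Relation.ReflTransGen (fun C D : SignedGraph V => ∃ w, D = C.switchAt w) A B

/-- `f` is a homomorphism of signed graphs: some signed graph switching equivalent to `G` is mapped
by `f` to `H` so that at least positive edges go to at least positive edges, and at least negative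
edges to at least negative edges. -/
def IsHom (G : SignedGraph V) (H : SignedGraph W) (f : V → W) : Prop :=
  ∃ G' : SignedGraph V, G.SwitchingEquivalent G' ∧
    (∀ u v, G'.pos u v → H.pos (f u) (f v)) ∧ (∀ u v, G'.neg u v → H.neg (f u) (f v))

/-- `white` and its complement (the black vertices) form a bipartition of the underlying graph of
`H`, and `lt` is a bipartite min ordering for it. The relation `lt` is the union of a strict linear
order of the white vertices and a strict linear order of the black vertices. -/
structure IsBipartiteMinOrdering (H : SignedGraph W) (white : Set W) (lt : W → W → Prop) :
    Prop where
  bipartite : ∀ x y, H.Adj x y → (x ∈ white ↔ y ∉ white)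
  same_colour : ∀ x y, lt x y → (x ∈ white ↔ y ∈ white)
  irrefl : ∀ x, ¬ lt x x
  trans : ∀ x y z, lt x y → lt y z → lt x z
  total : ∀ x y, (x ∈ white ↔ y ∈ white) → lt x y ∨ x = y ∨ lt y x
  min : ∀ x x' y y', x ∈ white → x' ∈ white → y ∉ white → y' ∉ white →
    lt x x' → lt y y' → H.Adj x y' → H.Adj x' y → H.Adj x y

/-- The bicoloured neighbours of every vertex precede its unicoloured neighbours. -/
structure IsSpecialBipartiteMinOrdering (H : SignedGraph W) (white : Set W) (lt : W → W → Prop) :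
    Prop extends IsBipartiteMinOrdering H white lt where
  special : ∀ x y y', H.Bicoloured x y → H.Unicoloured x y' → lt y y'

/-- An instance of the list homomorphism problem with target vertex set `W`: a finite signed graph
together with a list of allowed images for each of its vertices. -/
structure ListInstance (W : Type) where
  n : ℕ
  graph : SignedGraph (Fin n)
  list : Fin n → Finset W

/-- `f` is a list homomorphism of the instance to `H`. -/
def ListInstance.IsListHom (I : ListInstance W) (H : SignedGraph W) (f : Fin I.n → W) : Prop :=
  I.graph.IsHom H f ∧ ∀ v, f v ∈ I.list v

/-- The question asked by the list homomorphism problem for `H`. -/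
def ListInstance.HasListHom (I : ListInstance W) (H : SignedGraph W) : Prop :=
  ∃ f, I.IsListHom H f

/-- The input alphabet: one symbol for each possible list, and one symbol for each possible matrix
entry (is there a positive edge, is there a negative edge). It is finite when `W` is. -/
abbrev InputSymbol (W : Type) : Type := Finset W ⊕ (Bool × Bool)

open Classical in
/-- The input word: for each vertex its list followed by its row of the signed adjacency matrix.
It has `n * (n + 1)` symbols. -/
noncomputable def ListInstance.encode (I : ListInstance W) : List (InputSymbol W) :=
  (List.finRange I.n).flatMap fun u =>
    Sum.inl (I.list u) :: (List.finRange I.n).map fun v =>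
      Sum.inr (decide (I.graph.pos u v), decide (I.graph.neg u v))

open Classical in
/-- The list homomorphism problem for `H` is decided by a Turing machine in time polynomial in the
length of the input. -/
def ListSHomPolyTime (H : SignedGraph W) : Prop :=
  Nonempty (Turing.TM2ComputableInPolyTime (ListInstance.encode (W := W))
    Computability.encodeBool (fun I => decide (I.HasListHom H)))

open Classical in
/-- One round of the arc consistency test for the underlying graphs: from each list `L v` remove
each vertex of `H` that, for some edge `vu` of `G`, has no neighbour in `L u`. -/
noncomputable def arcRound {n : ℕ} (G : SignedGraph (Fin n)) (H : SignedGraph W)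
    (L : Fin n → Finset W) : Fin n → Finset W :=
  fun v => (L v).filter fun a => ∀ u, G.Adj v u → ∃ b ∈ L u, H.Adj a b

/-- The lists left by the arc consistency test. A round that changes some list removes at least one
of the at most `n * |W|` list entries, so after `n * |W|` rounds the lists are stable. -/
noncomputable def ListInstance.arcConsistent [Fintype W] (I : ListInstance W)
    (H : SignedGraph W) : Fin I.n → Finset W :=
  (arcRound I.graph H)^[I.n * Fintype.card W] I.list

/-- `m` is the minimum element of `S` in the strict order `lt`. -/
def IsMinimumOf (lt : W → W → Prop) (S : Finset W) (m : W) : Prop :=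
  m ∈ S ∧ ∀ a ∈ S, a ≠ m → lt m a

end SignedGraph

/-!
A homomorphism of signed graphs is a vertex map together with a set of switched vertices
(`isHom_iff`). Since `H` is uni-balanced, it can be switched so that all its unicoloured edges are
positive (`UniBalanced.exists_potential`). A map then respects the signs if and only if the input
can be switched so that all edges with unicoloured images become positive, a system of parity
constraints.

The key fact is `IsSpecialBipartiteMinOrdering.not_bicoloured_of_le`: if the unicoloured edges of
`H` form a connected spanning subgraph, then an edge lying above a unicoloured edge is never
bicoloured. Otherwise the set of vertices above such separated pairs of edges, enlarged by the lower
vertices adjacent to them, would be left by no unicoloured edge. Consequently, replacing the values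
of a list homomorphism by smaller ones only turns unicoloured images into bicoloured ones, as long
as the underlying edges remain edges, and this loses no sign condition (`edge_of_le`). The minima of
the arc consistent lists are adjacent by the min ordering property, and they lie below the values of
every list homomorphism, so they form a list homomorphism if there is one.

For polynomial time, lists of both colours have to be treated as well. The problem is regarded as a
binary constraint satisfaction problem whose values are pairs of a vertex of `H` and a switching
bit. It is decided by path consistency: for every pair of vertices of the input, the set of allowed
pairs of values is reduced until each pair extends to every third vertex
(`ListInstance.hasListHom_iff_nonempty`). If all sets stay non-empty, a colour can be chosen for
each component of the input, and the minima of the remaining values of that colour are the images.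
Their parity constraints are solvable by the key fact, because every remaining value of the right
colour gives an edge a unicoloured image whenever the minima do. Both the colours and the signs come
from one statement on path consistent families, `exists_potential_of_refine_eq`.

The sets of allowed pairs are letters of a finite alphabet, so path consistency only has to sweep
through a square matrix of letters. This is written in a small structured language, whose programs
are compiled to multi-stack machines with finite alphabets on all stacks, in such a way that the
number of steps is controlled (`RunsIn.iterate_step`, `PathMachine.main_runs`).
-/

/-! ### A structured programming language for multi-stack machines -/

namespace StackProg

open Turing

variable {K : Type} [DecidableEq K] {Γ : K → Type} {σ : Type}

variable (Γ σ) in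
/-- A store: the value of the finite register and the contents of the stacks. -/
abbrev Store : Type := σ × ∀ k, List (Γ k)

variable (Γ σ) in
/-- Basic operations, each of which is part of a single step of the machine. -/
inductive Op : Type
  | push (k : K) (f : σ → Γ k)
  | peek (k : K) (f : σ → Option (Γ k) → σ)
  | pop (k : K) (f : σ → Option (Γ k) → σ)
  | load (f : σ → σ)
  | when (c : σ → Bool) (op : Op)

/-- The effect of a basic operation on a store. -/
def Op.run : Op Γ σ → Store Γ σ → Store Γ σ
  | push k f, s => (s.1, Function.update s.2 k (f s.1 :: s.2 k))
  | peek k f, s => (f s.1 (s.2 k).head?, s.2)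
  | pop k f, s => (f s.1 (s.2 k).head?, Function.update s.2 k (s.2 k).tail)
  | load f, s => (f s.1, s.2)
  | when c op, s => cond (c s.1) (op.run s) s

/-- The machine statement that performs a basic operation and then continues with `q`. -/
def Op.toStmt {Λ : Type} : Op Γ σ → TM2.Stmt Γ Λ σ → TM2.Stmt Γ Λ σ
  | push k f, q => .push k f q
  | peek k f, q => .peek k f q
  | pop k f, q => .pop k f q
  | load f, q => .load f q
  | when c op, q => .branch c (op.toStmt q) q

theorem Op.stepAux_toStmt {Λ : Type} (op : Op Γ σ) (q : TM2.Stmt Γ Λ σ) (s : Store Γ σ) :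
    TM2.stepAux (op.toStmt q) s.1 s.2 = TM2.stepAux q (op.run s).1 (op.run s).2 := by
  induction op with
  | when c op ih =>
    simp only [toStmt, run, TM2.stepAux]
    cases c s.1
    · rfl
    · exact ih
  | _ => rfl

/-- The effect of a list of basic operations, performed from left to right. -/
def runOps : List (Op Γ σ) → Store Γ σ → Store Γ σ
  | [], s => s
  | op :: ops, s => runOps ops (op.run s)

/-- The machine statement that performs a list of basic operations and continues with `q`. -/
def opsToStmt {Λ : Type} : List (Op Γ σ) → TM2.Stmt Γ Λ σ → TM2.Stmt Γ Λ σ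
  | [], q => q
  | op :: ops, q => op.toStmt (opsToStmt ops q)

theorem stepAux_opsToStmt {Λ : Type} (ops : List (Op Γ σ)) (q : TM2.Stmt Γ Λ σ) (s : Store Γ σ) :
    TM2.stepAux (opsToStmt ops q) s.1 s.2 = TM2.stepAux q (runOps ops s).1 (runOps ops s).2 := by
  induction ops generalizing s with
  | nil => rfl
  | cons op ops ih => rw [opsToStmt, Op.stepAux_toStmt, ih, runOps]

variable (Γ σ) in
/-- Structured programs: straight-line code, composition, and loops. `loop ops test body` performs
`ops`; if `test` then holds of the register, it runs `body` and starts again, otherwise it ends. -/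
inductive Prog : Type
  | act (ops : List (Op Γ σ))
  | seq (p q : Prog)
  | loop (ops : List (Op Γ σ)) (test : σ → Bool) (body : Prog)

/-- `RunsIn p s t s'`: the program `p`, started in the store `s`, ends in the store `s'` after at
most `t` machine steps. -/
inductive RunsIn : Prog Γ σ → Store Γ σ → ℕ → Store Γ σ → Prop
  | act (ops : List (Op Γ σ)) (s : Store Γ σ) : RunsIn (.act ops) s 1 (runOps ops s)
  | seq {p q : Prog Γ σ} {s s' s'' : Store Γ σ} {t t' : ℕ} :
      RunsIn p s t s' → RunsIn q s' t' s'' → RunsIn (.seq p q) s (t + t') s''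
  | loop_done {ops : List (Op Γ σ)} {test : σ → Bool} {body : Prog Γ σ} {s : Store Γ σ} :
      test (runOps ops s).1 = false → RunsIn (.loop ops test body) s 1 (runOps ops s)
  | loop_step {ops : List (Op Γ σ)} {test : σ → Bool} {body : Prog Γ σ} {s s' s'' : Store Γ σ}
      {t t' : ℕ} : test (runOps ops s).1 = true → RunsIn body (runOps ops s) t s' →
      RunsIn (.loop ops test body) s' t' s'' → RunsIn (.loop ops test body) s (1 + t + t') s''
  | mono {p : Prog Γ σ} {s s' : Store Γ σ} {t t' : ℕ} :
      RunsIn p s t s' → t ≤ t' → RunsIn p s t' s'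

theorem RunsIn.cast {p : Prog Γ σ} {s s' s'' : Store Γ σ} {t t' : ℕ} (h : RunsIn p s t s')
    (ht : t ≤ t') (hs : s' = s'') : RunsIn p s t' s'' :=
  hs ▸ h.mono ht

/-- The control points of a program. -/
def Prog.Label : Prog Γ σ → Type
  | act _ => Unit
  | seq p q => p.Label ⊕ q.Label
  | loop _ _ body => Option body.Label

/-- A program has finitely many control points. -/
instance Prog.instFintypeLabel : ∀ p : Prog Γ σ, Fintype p.Label
  | act _ => inferInstanceAs (Fintype Unit)
  | seq p q =>
    haveI := instFintypeLabel p
    haveI := instFintypeLabel q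
    inferInstanceAs (Fintype (p.Label ⊕ q.Label))
  | loop _ _ body =>
    haveI := instFintypeLabel body
    inferInstanceAs (Fintype (Option body.Label))

/-- The control point at which a program starts. -/
def Prog.start : ∀ p : Prog Γ σ, p.Label
  | act _ => ()
  | seq p _ => Sum.inl p.start
  | loop _ _ _ => none

/-- The machine code of a program whose control points are embedded by `ι` into the labels of a
larger machine, and which jumps to the label `exit` when it ends. -/
def Prog.code {Λ : Type} : ∀ p : Prog Γ σ, (p.Label → Λ) → Λ → p.Label → TM2.Stmt Γ Λ σ
  | act ops, _, exit, _ => opsToStmt ops (.goto fun _ => exit)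
  | seq p q, ι, _, Sum.inl l => p.code (ι ∘ Sum.inl) (ι (Sum.inr q.start)) l
  | seq _ q, ι, exit, Sum.inr l => q.code (ι ∘ Sum.inr) exit l
  | loop ops test body, ι, exit, none =>
    opsToStmt ops (.branch test (.goto fun _ => ι (some body.start)) (.goto fun _ => exit))
  | loop _ _ body, ι, _, some l => body.code (ι ∘ some) (ι none) l

theorem flip_bind_some {α β : Type} (f : α → Option β) (a : α) : flip bind f (some a) = f a := rfl

/-- A machine that contains the code of a program simulates it within the stated time. -/
theorem RunsIn.iterate_step {Λ : Type} (m : Λ → TM2.Stmt Γ Λ σ) {p : Prog Γ σ} {s s' : Store Γ σ}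
    {t : ℕ} (h : RunsIn p s t s') : ∀ (ι : p.Label → Λ) (exit : Λ),
      (∀ l, m (ι l) = p.code ι exit l) → ∃ t' ≤ t,
        (flip bind (TM2.step m))^[t'] (some ⟨some (ι p.start), s.1, s.2⟩) =
          some ⟨some exit, s'.1, s'.2⟩ := by
  induction h with
  | act ops s =>
    intro ι exit hm
    refine ⟨1, le_rfl, ?_⟩
    rw [Function.iterate_one, flip_bind_some, TM2.step, hm]
    exact congrArg some (stepAux_opsToStmt ops _ s)
  | seq _ _ ihp ihq =>
    intro ι exit hm
    obtain ⟨t₁, h₁, e₁⟩ := ihp (ι ∘ Sum.inl) _ fun l => hm (Sum.inl l)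
    obtain ⟨t₂, h₂, e₂⟩ := ihq (ι ∘ Sum.inr) _ fun l => hm (Sum.inr l)
    refine ⟨t₂ + t₁, by omega, ?_⟩
    rw [Function.iterate_add_apply]
    exact (congrArg _ e₁).trans e₂
  | @loop_done ops test body s hf =>
    intro ι exit hm
    refine ⟨1, le_rfl, ?_⟩
    rw [Function.iterate_one, flip_bind_some, TM2.step, hm]
    refine congrArg some ((stepAux_opsToStmt ops _ s).trans ?_)
    simp only [TM2.stepAux, hf, cond_false]
  | @loop_step ops test body s s' s'' t t' hf _ _ ihb ihl =>
    intro ι exit hm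
    obtain ⟨t₁, h₁, e₁⟩ := ihb (ι ∘ some) _ fun l => hm (some l)
    obtain ⟨t₂, h₂, e₂⟩ := ihl ι exit hm
    have e₀ : (flip bind (TM2.step m)) (some ⟨some (ι (Prog.loop ops test body).start), s.1, s.2⟩) =
        some ⟨some (ι (some body.start)), (runOps ops s).1, (runOps ops s).2⟩ := by
      rw [flip_bind_some, TM2.step, hm]
      refine congrArg some ((stepAux_opsToStmt ops _ s).trans ?_)
      simp only [TM2.stepAux, hf, cond_true]
    refine ⟨t₂ + (t₁ + 1), by omega, ?_⟩
    rw [Function.iterate_add_apply, Function.iterate_add_apply, Function.iterate_one, e₀]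
    exact (congrArg _ e₁).trans e₂
  | mono _ hle ih =>
    intro ι exit hm
    obtain ⟨t₁, h₁, e₁⟩ := ih ι exit hm
    exact ⟨t₁, h₁.trans hle, e₁⟩

/-- The Turing machine of a program: the label `none` is reached when the program ends, and halts.
All stacks are required to have finite alphabets. -/
def Prog.machine [Fintype K] [∀ k, Fintype (Γ k)] [Fintype σ] (p : Prog Γ σ) (k₀ k₁ : K)
    (init : σ) : FinTM2 where
  K := K
  k₀ := k₀
  k₁ := k₁
  Γ := Γ
  Λ := Option p.Label
  main := some p.start
  σ := σ
  initialState := init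
  m
    | none => .halt
    | some l => p.code some none l

/-- If a program turns every encoded input on the input stack into the encoded output on the output
stack, with the other stacks empty before and after, and within a time polynomial in the length of
the encoded input, then its machine computes the function in polynomial time. -/
theorem Prog.computableInPolyTime [Fintype K] [∀ k, Fintype (Γ k)] [Fintype σ] (p : Prog Γ σ)
    (k₀ k₁ : K) (init : σ) {α β : Type} (ea : α → List (Γ k₀)) (eb : β → List (Γ k₁)) (f : α → β)
    (time : Polynomial ℕ)
    (h : ∀ a, RunsIn p (init, Function.update (fun _ => []) k₀ (ea a)) (time.eval (ea a).length)
      (init, Function.update (fun _ => []) k₁ (eb (f a)))) :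
    Nonempty (TM2ComputableInPolyTime ea eb f) := by
  let tm := p.machine k₀ k₁ init
  have hinit : ∀ l : List (Γ k₀), initList tm l =
      ⟨some (some p.start), init, (Function.update (fun _ => []) k₀ l : ∀ k, List (Γ k))⟩ := by
    intro l
    simp only [initList, tm, machine]
    congr 1
    funext k
    by_cases hk : k = k₀
    · subst hk
      exact (dif_pos rfl).trans
        (Function.update_self (β := fun k => List (Γ k)) k l fun _ => []).symm
    · exact (dif_neg hk).trans
        (Function.update_of_ne (β := fun k => List (Γ k)) hk l fun _ => []).symm
  have hhalt : ∀ l : List (Γ k₁), haltList tm l =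
      ⟨none, init, (Function.update (fun _ => []) k₁ l : ∀ k, List (Γ k))⟩ := by
    intro l
    simp only [haltList, tm, machine]
    congr 1
    funext k
    by_cases hk : k = k₁
    · subst hk
      exact (dif_pos rfl).trans
        (Function.update_self (β := fun k => List (Γ k)) k l fun _ => []).symm
    · exact (dif_neg hk).trans
        (Function.update_of_ne (β := fun k => List (Γ k)) hk l fun _ => []).symm
  refine ⟨⟨⟨tm, Equiv.refl (Γ k₀), Equiv.refl (Γ k₁)⟩, time + 1, fun a => Classical.choice ?_⟩⟩
  obtain ⟨t, ht, e⟩ := (h a).iterate_step tm.m some none fun _ => rfl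
  have key : (flip bind tm.step)^[t + 1] (some (initList tm (ea a))) =
      some (haltList tm (eb (f a))) := by
    rw [Function.iterate_succ_apply', hinit, hhalt]
    exact congrArg (flip bind (TM2.step tm.m)) e
  have out : TM2OutputsInTime tm (ea a) (some (eb (f a))) ((time + 1).eval (ea a).length) :=
    ⟨⟨t + 1, key⟩, by simpa using ht⟩
  have hin : (ea a).map (Equiv.refl (Γ k₀)).invFun = ea a := List.map_id _
  have hout : (eb (f a)).map (Equiv.refl (Γ k₁)).invFun = eb (f a) := List.map_id _
  rw [← hin, ← hout] at out
  rw [List.length_map] at out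
  exact ⟨out⟩

end StackProg

/-! ### Iterating a map that decreases a measure -/

theorem iterate_fixed_of_measure {α : Type*} (f : α → α) (μ : α → ℕ)
    (h : ∀ x, f x ≠ x → μ (f x) < μ x) (N : ℕ) (x : α) (hx : μ x ≤ N) :
    f (f^[N] x) = f^[N] x := by
  induction N generalizing x with
  | zero =>
    by_contra hne
    exact absurd (h x hne) (by omega)
  | succ N ih =>
    by_cases hfx : f x = x
    · rw [Function.iterate_fixed hfx, hfx]
    · exact ih (f x) (by have := h x hfx; omega)

namespace SignedGraph

variable {V W : Type}

/-! ### Signs and switching -/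

theorem xor_xor_xor_comm (c a b p q : Bool) :
    (c ^^ (a ^^ b) ^^ (p ^^ q)) = (c ^^ (p ^^ a ^^ (q ^^ b))) := by
  revert c a b p q
  decide

/-- `A.Edge c u v` says that `uv` is at least an edge of the sign `c`, where `false` stands for
positive and `true` for negative. -/
def Edge (A : SignedGraph V) (c : Bool) (u v : V) : Prop := bif c then A.neg u v else A.pos u v

theorem Adj.symm {A : SignedGraph V} {u v : V} (h : A.Adj u v) : A.Adj v u :=
  h.imp (A.pos_symm _ _) (A.neg_symm _ _)

theorem Bicoloured.symm {A : SignedGraph V} {u v : V} (h : A.Bicoloured u v) : A.Bicoloured v u :=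
  ⟨A.pos_symm _ _ h.1, A.neg_symm _ _ h.2⟩

theorem Unicoloured.symm {A : SignedGraph V} {u v : V} (h : A.Unicoloured u v) :
    A.Unicoloured v u :=
  ⟨h.1.symm, fun hb => h.2 hb.symm⟩

theorem Bicoloured.adj {A : SignedGraph V} {u v : V} (h : A.Bicoloured u v) : A.Adj u v :=
  Or.inl h.1

theorem Edge.adj {A : SignedGraph V} {c : Bool} {u v : V} (h : A.Edge c u v) : A.Adj u v := by
  cases c
  · exact Or.inl h
  · exact Or.inr h

theorem Adj.exists_edge {A : SignedGraph V} {u v : V} (h : A.Adj u v) : ∃ c, A.Edge c u v :=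
  h.elim (fun h => ⟨false, h⟩) fun h => ⟨true, h⟩

theorem Bicoloured.edge {A : SignedGraph V} {u v : V} (h : A.Bicoloured u v) (c : Bool) :
    A.Edge c u v := by
  cases c
  · exact h.1
  · exact h.2

open Classical in
theorem switchAt_edge (A : SignedGraph V) (w u v : V) (c : Bool) :
    (A.switchAt w).Edge c u v ↔ A.Edge (c ^^ (decide (u = w) ^^ decide (v = w))) u v := by
  by_cases hu : u = w <;> by_cases hv : v = w <;> cases c <;>
    simp [Edge, switchAt, hu, hv, Xor]

open Classical in
theorem SwitchingEquivalent.exists_edge_iff {A B : SignedGraph V} (h : A.SwitchingEquivalent B) :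
    ∃ s : V → Bool, ∀ c u v, B.Edge c u v ↔ A.Edge (c ^^ (s u ^^ s v)) u v := by
  induction h with
  | refl => exact ⟨fun _ => false, by simp⟩
  | tail _ hstep ih =>
    obtain ⟨s, hs⟩ := ih
    obtain ⟨w, rfl⟩ := hstep
    refine ⟨fun u => s u ^^ decide (u = w), fun c u v => ?_⟩
    rw [switchAt_edge, hs, xor_xor_xor_comm]

open Classical in
theorem exists_switchingEquivalent (A : SignedGraph V) (T : Finset V) :
    ∃ B, A.SwitchingEquivalent B ∧
      ∀ c u v, B.Edge c u v ↔ A.Edge (c ^^ (decide (u ∈ T) ^^ decide (v ∈ T))) u v := by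
  induction T using Finset.induction_on with
  | empty => exact ⟨A, .refl, by simp⟩
  | insert w T hw ih =>
    obtain ⟨B, hAB, hB⟩ := ih
    refine ⟨B.switchAt w, hAB.tail ⟨w, rfl⟩, fun c u v => ?_⟩
    have key : ∀ x, decide (x ∈ insert w T) = (decide (x ∈ T) ^^ decide (x = w)) := by
      intro x
      by_cases hx : x = w
      · subst hx; simp [hw]
      · simp [hx]
    rw [switchAt_edge, hB, key, key, xor_xor_xor_comm]

/-- A homomorphism is a vertex map together with the set of switched vertices, encoded by its
characteristic function `s`: the sign of the image of `uv` is corrected by `s u ^^ s v`. -/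
theorem isHom_iff [Fintype V] (G : SignedGraph V) (H : SignedGraph W) (f : V → W) :
    G.IsHom H f ↔ ∃ s : V → Bool, ∀ c u v, G.Edge c u v →
      H.Edge (c ^^ (s u ^^ s v)) (f u) (f v) := by
  classical
  constructor
  · rintro ⟨B, hGB, hpos, hneg⟩
    obtain ⟨s, hs⟩ := hGB.exists_edge_iff
    refine ⟨s, fun c u v h => ?_⟩
    have hB : B.Edge (c ^^ (s u ^^ s v)) u v := by
      rw [hs, Bool.xor_assoc, Bool.xor_self, Bool.xor_false]
      exact h
    revert hB
    cases (c ^^ (s u ^^ s v))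
    · exact hpos u v
    · exact hneg u v
  · rintro ⟨s, hs⟩
    obtain ⟨B, hGB, hB⟩ := G.exists_switchingEquivalent (Finset.univ.filter fun u => s u)
    have key : ∀ c u v, B.Edge c u v → H.Edge c (f u) (f v) := by
      intro c u v h
      have h' := hs _ u v ((hB c u v).1 h)
      simpa using h'
    exact ⟨B, hGB, key false, key true⟩

/-! ### Normalizing the signs of the unicoloured edges -/

section Balanced

variable {H : SignedGraph W}

theorem redCount_append {u v w : W} (p : H.uniGraph.Walk u v) (q : H.uniGraph.Walk v w) :
    H.redCount (p.append q) = H.redCount p + H.redCount q := by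
  simp [redCount, SimpleGraph.Walk.darts_append]

open Classical in
theorem redCount_cons {u v w : W} (h : H.uniGraph.Adj u v) (p : H.uniGraph.Walk v w) :
    H.redCount (.cons h p) = H.redCount p + if H.neg u v then 1 else 0 := by
  simp [redCount, List.countP_cons]

theorem redCount_reverse {u v : W} (p : H.uniGraph.Walk u v) :
    H.redCount p.reverse = H.redCount p := by
  classical
  induction p with
  | nil => rfl
  | @cons u v w h p ih =>
    have hs : H.neg v u ↔ H.neg u v := ⟨H.neg_symm _ _, H.neg_symm _ _⟩
    rw [SimpleGraph.Walk.reverse_cons, redCount_append, ih, redCount_cons, redCount_cons]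
    simp [hs, redCount]

/-- A path closed up by an edge is a cycle, unless the path is that edge itself. -/
theorem UniBalanced.even_cons (hbal : H.UniBalanced) {u v : W} (h : H.uniGraph.Adj u v)
    {p : H.uniGraph.Walk v u} (hp : p.IsPath) : Even (H.redCount (.cons h p)) := by
  classical
  by_cases he : s(u, v) ∈ p.edges
  · cases p with
    | nil => exact absurd rfl h.ne
    | @cons _ w _ h' q =>
      rw [SimpleGraph.Walk.cons_isPath_iff] at hp
      rw [SimpleGraph.Walk.edges_cons, List.mem_cons] at he
      rcases he with he | he
      · have hwu : w = u := by
          rcases Sym2.eq_iff.1 he with ⟨h1, _⟩ | ⟨h1, _⟩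
          · exact absurd h1 h.ne
          · exact h1.symm
        subst hwu
        obtain rfl := (SimpleGraph.Walk.isPath_iff_nil.1 hp.1).eq_nil
        have hs : H.neg v w ↔ H.neg w v := ⟨H.neg_symm _ _, H.neg_symm _ _⟩
        rw [redCount_cons, redCount_cons]
        by_cases hn : H.neg w v <;> simp [hs, hn, redCount]
      · exact absurd (SimpleGraph.Walk.snd_mem_support_of_mem_edges _ he) hp.2
  · exact hbal.1 _ _ ((SimpleGraph.Walk.cons_isCycle_iff _ _).2 ⟨hp, he⟩)

open Classical in
theorem UniBalanced.even_redCount_bypass (hbal : H.UniBalanced) {u v : W}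
    (p : H.uniGraph.Walk u v) : Even (H.redCount p) ↔ Even (H.redCount p.bypass) := by
  induction p with
  | nil => rfl
  | @cons u v w h p ih =>
    rw [SimpleGraph.Walk.bypass]
    split_ifs with hs
    · have e := hbal.even_cons h (p.bypass_isPath.takeUntil hs)
      have e' := congrArg H.redCount (p.bypass.take_spec hs)
      rw [redCount_append] at e'
      rw [redCount_cons] at e ⊢
      rw [← e'] at ih
      rw [Nat.even_add] at e ih ⊢
      rw [ih]
      tauto
    · rw [redCount_cons, redCount_cons, Nat.even_add, Nat.even_add, ih]

theorem UniBalanced.even_redCount (hbal : H.UniBalanced) {u : W} (p : H.uniGraph.Walk u u) :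
    Even (H.redCount p) := by
  classical
  rw [hbal.even_redCount_bypass, (SimpleGraph.Walk.isPath_iff_nil.1 p.bypass_isPath).eq_nil]
  simp [redCount]

/-- In a uni-balanced graph the unicoloured edges can all be made positive by switching: there is a
set of vertices, with characteristic function `t`, such that the red unicoloured edges are those
that leave it. -/
theorem UniBalanced.exists_potential (hirr : H.Irreflexive) (hbal : H.UniBalanced)
    (hconn : H.uniGraph.Connected) :
    ∃ t : W → Bool, ∀ c x y, H.Unicoloured x y → (H.Edge c x y ↔ c = (t x ^^ t y)) := by
  classical
  obtain ⟨r⟩ := hconn.nonempty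
  let p : ∀ x, H.uniGraph.Walk r x := fun x => (hconn.preconnected r x).some
  refine ⟨fun x => decide (Even (H.redCount (p x))), fun c x y hxy => ?_⟩
  have hne : x ≠ y := fun h => hirr y (h ▸ hxy.1)
  have hadj : H.uniGraph.Adj x y := ⟨hne, hxy⟩
  have e := hbal.even_redCount ((p x).append (.cons hadj (p y).reverse))
  rw [redCount_append, redCount_cons, redCount_reverse, Nat.even_add, Nat.even_add] at e
  have hu : H.pos x y ↔ ¬ H.neg x y :=
    ⟨fun h h' => hxy.2 ⟨h, h'⟩, fun h => hxy.1.resolve_right h⟩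
  by_cases hx : Even (H.redCount (p x)) <;> by_cases hy : Even (H.redCount (p y)) <;>
    by_cases hn : H.neg x y <;> cases c <;> simp_all [Edge]
  all_goals exact iff_of_false (Nat.not_even_iff_odd.2 hx) (Nat.not_even_iff_odd.2 hy)

end Balanced

/-! ### Special bipartite min orderings -/

section Ordering

variable {H : SignedGraph W} {white : Set W} {lt : W → W → Prop}

theorem IsBipartiteMinOrdering.not_lt_of_adj (h : H.IsBipartiteMinOrdering white lt) {x y : W}
    (hxy : H.Adj x y) : ¬ lt x y := fun hlt => by
  have h1 := h.bipartite x y hxy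
  have h2 := h.same_colour x y hlt
  tauto

open Classical in
theorem IsBipartiteMinOrdering.decide_mem_white (h : H.IsBipartiteMinOrdering white lt) {x y : W}
    (hxy : H.Adj x y) : decide (y ∈ white) = !decide (x ∈ white) := by
  have := h.bipartite x y hxy
  by_cases hx : x ∈ white <;> by_cases hy : y ∈ white <;> simp_all

/-- The defining property of a min ordering, with the colours of the vertices left implicit. -/
theorem IsBipartiteMinOrdering.adj_of_lt_of_lt (h : H.IsBipartiteMinOrdering white lt)
    {x x' y y' : W} (hx : lt x x') (hy : lt y y') (h1 : H.Adj x y') (h2 : H.Adj x' y) :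
    H.Adj x y := by
  have cx := h.same_colour x x' hx
  have cy := h.same_colour y y' hy
  have c1 := h.bipartite x y' h1
  by_cases hw : x ∈ white
  · exact h.min x x' y y' hw (cx.1 hw) (fun hy' => c1.1 hw (cy.1 hy')) (c1.1 hw) hx hy h1 h2
  · have hy'w : y' ∈ white := by tauto
    exact (h.min y y' x x' (cy.2 hy'w) hy'w hw (fun hx' => hw (cx.2 hx')) hy hx h2.symm
      h1.symm).symm

/-- The min ordering property for the reflexive closures of the orders. -/
theorem IsBipartiteMinOrdering.adj_of_le_of_le (h : H.IsBipartiteMinOrdering white lt)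
    {x x' y y' : W} (hx : x = x' ∨ lt x x') (hy : y = y' ∨ lt y y') (h1 : H.Adj x y')
    (h2 : H.Adj x' y) : H.Adj x y := by
  rcases hx with rfl | hx
  · exact h2
  rcases hy with rfl | hy
  · exact h1
  exact h.adj_of_lt_of_lt hx hy h1 h2

theorem IsSpecialBipartiteMinOrdering.bicoloured_of_not_lt
    (h : H.IsSpecialBipartiteMinOrdering white lt) {x y z : W} (hy : H.Bicoloured x y)
    (hz : H.Adj x z) (hlt : ¬ lt y z) : H.Bicoloured x z := by
  by_contra hb
  exact hlt (h.special x y z hy ⟨hz, hb⟩)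

/-- A bicoloured edge `xy` above the edge `ab`, with no edges between the two. -/
def IsSeparated (H : SignedGraph W) (lt : W → W → Prop) (a b x y : W) : Prop :=
  lt a x ∧ lt b y ∧ H.Bicoloured x y ∧ ¬ H.Adj x b ∧ ¬ H.Adj a y

/-- The vertices on the side of `a` that lie above a bicoloured edge separated from `ab`, and the
vertices on the side of `b` that lie below `b` and are adjacent to such an edge. -/
def upperSet (H : SignedGraph W) (lt : W → W → Prop) (a b : W) : Set W :=
  {p | ∃ x y, IsSeparated H lt a b x y ∧ (p = x ∨ lt x p ∨ (lt p b ∧ H.Adj x p))}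

theorem IsSeparated.swap {a b x y : W} (h : IsSeparated H lt a b x y) :
    IsSeparated H lt b a y x :=
  ⟨h.2.1, h.1, h.2.2.1.symm, fun h' => h.2.2.2.2 h'.symm, fun h' => h.2.2.2.1 h'.symm⟩

/-- The unicoloured edges do not leave the union of the two upper sets of a unicoloured edge. -/
theorem IsSpecialBipartiteMinOrdering.upperSet_closed
    (h : H.IsSpecialBipartiteMinOrdering white lt) {a b p q : W} (hab : H.Unicoloured a b)
    (hp : p ∈ upperSet H lt a b) (hpq : H.Unicoloured p q) :
    q ∈ upperSet H lt a b ∨ q ∈ upperSet H lt b a := by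
  obtain ⟨x, y, hs, hp⟩ := hp
  obtain ⟨hax, hby, hxy, hxb, hay⟩ := hs
  have hby' := h.same_colour b y hby
  have hax' := h.same_colour a x hax
  rcases hp with rfl | hxp | ⟨hpb, hxp⟩
  · exact Or.inr ⟨y, p, IsSeparated.swap ⟨hax, hby, hxy, hxb, hay⟩,
      Or.inr (Or.inl (h.special p y q hxy hpq))⟩
  · have hcol : y ∈ white ↔ q ∈ white := by
      have h1 := h.bipartite x y hxy.adj
      have h2 := h.bipartite p q hpq.1
      have h3 := h.same_colour x p hxp
      tauto
    rcases h.total y q hcol with hyq | rfl | hqy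
    · exact Or.inr ⟨y, x, IsSeparated.swap ⟨hax, hby, hxy, hxb, hay⟩, Or.inr (Or.inl hyq)⟩
    · exact Or.inr ⟨y, x, IsSeparated.swap ⟨hax, hby, hxy, hxb, hay⟩, Or.inl rfl⟩
    · have hxq : H.Adj x q := h.adj_of_lt_of_lt hxp hqy hxy.adj hpq.1
      have hbq : H.Bicoloured x q :=
        h.bicoloured_of_not_lt hxy hxq fun hyq => h.irrefl _ (h.trans _ _ _ hyq hqy)
      rcases h.total q b (hcol.symm.trans hby'.symm) with hqb | rfl | hlt
      · exact Or.inl ⟨x, y, ⟨hax, hby, hxy, hxb, hay⟩, Or.inr (Or.inr ⟨hqb, hxq⟩)⟩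
      · exact absurd hxq hxb
      · refine Or.inr ⟨q, x, IsSeparated.swap ⟨hax, hlt, hbq, hxb, fun haq => ?_⟩, Or.inl rfl⟩
        have hqa : H.Bicoloured q a :=
          h.bicoloured_of_not_lt hbq.symm haq.symm fun hxa => h.irrefl _ (h.trans _ _ _ hax hxa)
        exact h.irrefl _ (h.trans _ _ _ hlt (h.special a q b hqa.symm hab))
  · have hbp : H.Bicoloured x p := h.bicoloured_of_not_lt hxy hxp fun hyp =>
      h.irrefl _ (h.trans _ _ _ (h.trans _ _ _ hby hyp) hpb)
    exact Or.inl ⟨x, y, ⟨hax, hby, hxy, hxb, hay⟩,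
      Or.inr (Or.inl (h.special p x q hbp.symm hpq))⟩

theorem IsSpecialBipartiteMinOrdering.notMem_upperSet
    (h : H.IsSpecialBipartiteMinOrdering white lt) {a b : W} (hab : H.Adj a b) :
    a ∉ upperSet H lt a b ∧ a ∉ upperSet H lt b a := by
  constructor
  · rintro ⟨x, y, hs, rfl | hxa | ⟨hlt, _⟩⟩
    · exact h.irrefl _ hs.1
    · exact h.irrefl _ (h.trans _ _ _ hs.1 hxa)
    · exact h.not_lt_of_adj hab hlt
  · rintro ⟨x, y, hs, rfl | hxa | ⟨hlt, _⟩⟩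
    · exact h.not_lt_of_adj hab.symm hs.1
    · exact h.not_lt_of_adj hab.symm (h.trans _ _ _ hs.1 hxa)
    · exact h.irrefl _ hlt

/-- No edge above a unicoloured edge is bicoloured. This is where it matters that the unicoloured
edges form a connected spanning subgraph. -/
theorem IsSpecialBipartiteMinOrdering.not_bicoloured_of_le
    (h : H.IsSpecialBipartiteMinOrdering white lt) (hconn : H.uniGraph.Connected) {a b x y : W}
    (hax : a = x ∨ lt a x) (hby : b = y ∨ lt b y) (hab : H.Unicoloured a b) :
    ¬ H.Bicoloured x y := by
  intro hxy
  rcases hax with rfl | hax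
  · rcases hby with rfl | hby
    · exact hab.2 hxy
    · exact h.irrefl _ (h.trans _ _ _ hby (h.special a y b hxy hab))
  rcases hby with rfl | hby
  · exact h.irrefl _ (h.trans _ _ _ hax (h.special b x a hxy.symm hab.symm))
  have hay : ¬ H.Adj a y := fun hay => by
    have hb : H.Bicoloured y a := h.bicoloured_of_not_lt hxy.symm hay.symm fun hxa =>
      h.irrefl _ (h.trans _ _ _ hax hxa)
    exact h.irrefl _ (h.trans _ _ _ hby (h.special a y b hb.symm hab))
  have hxb : ¬ H.Adj x b := fun hxb => by
    have hb : H.Bicoloured x b := h.bicoloured_of_not_lt hxy hxb fun hyb =>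
      h.irrefl _ (h.trans _ _ _ hby hyb)
    exact h.irrefl _ (h.trans _ _ _ hax (h.special b x a hb.symm hab.symm))
  have hreach : ∀ p q, H.uniGraph.Walk p q → p ∈ upperSet H lt a b ∪ upperSet H lt b a →
      q ∈ upperSet H lt a b ∪ upperSet H lt b a := by
    intro p q w
    induction w with
    | nil => exact id
    | cons hadj _ ih =>
      rintro (hp | hp)
      · exact ih (h.upperSet_closed hab hp hadj.2)
      · exact ih (h.upperSet_closed hab.symm hp hadj.2).symm
  obtain ⟨w⟩ := hconn.preconnected x a
  exact (hreach x a w (Or.inl ⟨x, y, ⟨hax, hby, hxy, hxb, hay⟩, Or.inl rfl⟩)).elim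
    (h.notMem_upperSet hab.1).1 (h.notMem_upperSet hab.1).2

/-- If the image of an edge is moved down along the ordering, it keeps its sign up to the
switching `t` that makes all unicoloured edges positive. -/
theorem IsSpecialBipartiteMinOrdering.edge_of_le
    (h : H.IsSpecialBipartiteMinOrdering white lt) (hconn : H.uniGraph.Connected) {t : W → Bool}
    (ht : ∀ c x y, H.Unicoloured x y → (H.Edge c x y ↔ c = (t x ^^ t y))) {a b x y : W} {c : Bool}
    (hax : a = x ∨ lt a x) (hby : b = y ∨ lt b y) (hab : H.Adj a b) (hxy : H.Edge c x y) :
    H.Edge (c ^^ ((t x ^^ t a) ^^ (t y ^^ t b))) a b := by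
  by_cases hb : H.Bicoloured a b
  · exact hb.edge _
  · have hc := (ht c x y ⟨hxy.adj, h.not_bicoloured_of_le hconn hax hby ⟨hab, hb⟩⟩).1 hxy
    rw [ht _ _ _ ⟨hab, hb⟩, hc]
    generalize t x = p, t y = q, t a = r, t b = s
    revert p q r s
    decide

theorem IsBipartiteMinOrdering.exists_isMinimumOf (h : H.IsBipartiteMinOrdering white lt)
    (S : Finset W) (hne : S.Nonempty) (hcol : ∀ a ∈ S, ∀ b ∈ S, a ∈ white ↔ b ∈ white) :
    ∃ m, IsMinimumOf lt S m := by
  classical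
  induction hne using Finset.Nonempty.cons_induction with
  | singleton a => exact ⟨a, by simp [IsMinimumOf]⟩
  | cons a S ha hS ih =>
    obtain ⟨m, hm, hmin⟩ := ih fun b hb c hc =>
      hcol b (Finset.mem_cons_of_mem hb) c (Finset.mem_cons_of_mem hc)
    rcases h.total a m (hcol a (Finset.mem_cons_self a S) m (Finset.mem_cons_of_mem hm)) with
      hlt | rfl | hlt
    · refine ⟨a, Finset.mem_cons_self a S, fun b hb hba => ?_⟩
      have hbS := (Finset.mem_cons.1 hb).resolve_left hba
      by_cases hbm : b = m
      · exact hbm ▸ hlt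
      · exact h.trans _ _ _ hlt (hmin b hbS hbm)
    · exact absurd hm ha
    · refine ⟨m, Finset.mem_cons_of_mem hm, fun b hb hbm => ?_⟩
      rcases Finset.mem_cons.1 hb with rfl | hbS
      · exact hlt
      · exact hmin b hbS hbm

theorem IsMinimumOf.le {S : Finset W} {m a : W} (hm : IsMinimumOf lt S m) (ha : a ∈ S) :
    m = a ∨ lt m a := by
  by_cases h : a = m
  · exact Or.inl h.symm
  · exact Or.inr (hm.2 a ha h)

/-- The minima of two lists that support each other are adjacent. -/
theorem IsBipartiteMinOrdering.adj_of_isMinimumOf (h : H.IsBipartiteMinOrdering white lt)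
    {S T : Finset W} {a b : W} (ha : IsMinimumOf lt S a) (hb : IsMinimumOf lt T b)
    (hST : ∃ y ∈ T, H.Adj a y) (hTS : ∃ x ∈ S, H.Adj b x) : H.Adj a b := by
  obtain ⟨y, hy, hay⟩ := hST
  obtain ⟨x, hx, hbx⟩ := hTS
  exact h.adj_of_le_of_le (ha.le hx) (hb.le hy) hay hbx.symm

end Ordering

/-! ### The arc consistency test -/

section ArcConsistency

variable {H : SignedGraph W}

open Classical in
theorem arcRound_subset {n : ℕ} (G : SignedGraph (Fin n)) (L : Fin n → Finset W) (v : Fin n) :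
    arcRound G H L v ⊆ L v :=
  Finset.filter_subset _ _

theorem sum_card_arcRound_lt {n : ℕ} (G : SignedGraph (Fin n)) (L : Fin n → Finset W)
    (hne : arcRound G H L ≠ L) :
    ∑ v, (arcRound G H L v).card < ∑ v, (L v).card := by
  obtain ⟨v, hv⟩ := Function.ne_iff.1 hne
  exact Finset.sum_lt_sum (fun u _ => Finset.card_le_card (arcRound_subset G L u))
    ⟨v, Finset.mem_univ v, Finset.card_lt_card ((arcRound_subset G L v).ssubset_of_ne hv)⟩

variable [Fintype W]

/-- The rounds performed by the arc consistency test suffice to make the lists stable. -/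
theorem ListInstance.arcRound_arcConsistent (I : ListInstance W) (H : SignedGraph W) :
    arcRound I.graph H (I.arcConsistent H) = I.arcConsistent H := by
  refine iterate_fixed_of_measure (arcRound I.graph H) (fun L => ∑ v, (L v).card)
    (fun L hL => sum_card_arcRound_lt I.graph L hL) _ I.list ?_
  calc ∑ v, (I.list v).card ≤ ∑ _v : Fin I.n, Fintype.card W :=
        Finset.sum_le_sum fun v _ => Finset.card_le_univ _
    _ = I.n * Fintype.card W := by simp

theorem ListInstance.arcConsistent_subset (I : ListInstance W) (v : Fin I.n) :
    I.arcConsistent H v ⊆ I.list v := by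
  unfold ListInstance.arcConsistent
  generalize I.n * Fintype.card W = N
  induction N with
  | zero => rfl
  | succ N ih =>
    rw [Function.iterate_succ_apply']
    exact (arcRound_subset _ _ v).trans ih

theorem ListInstance.exists_mem_arcConsistent_adj (I : ListInstance W) {u v : Fin I.n}
    (huv : I.graph.Adj u v) {a : W} (ha : a ∈ I.arcConsistent H u) :
    ∃ b ∈ I.arcConsistent H v, H.Adj a b := by
  classical
  rw [← I.arcRound_arcConsistent H, arcRound, Finset.mem_filter] at ha
  exact ha.2 v huv

/-- The arc consistency test keeps the values of every list homomorphism of underlying graphs. -/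
theorem ListInstance.mem_arcConsistent (I : ListInstance W) {f : Fin I.n → W}
    (hf : ∀ u v, I.graph.Adj u v → H.Adj (f u) (f v)) (hl : ∀ v, f v ∈ I.list v) (v : Fin I.n) :
    f v ∈ I.arcConsistent H v := by
  classical
  unfold ListInstance.arcConsistent
  generalize I.n * Fintype.card W = N
  induction N generalizing v with
  | zero => exact hl v
  | succ N ih =>
    rw [Function.iterate_succ_apply', arcRound, Finset.mem_filter]
    exact ⟨ih v, fun u hu => ⟨f u, ih u, hf v u hu⟩⟩

/-- The minima of the arc consistent lists form a list homomorphism as soon as one exists. -/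
theorem ListInstance.exists_minimum_isListHom {white : Set W} {lt : W → W → Prop}
    (hirr : H.Irreflexive) (hbal : H.UniBalanced) (hconn : H.uniGraph.Connected)
    (hord : H.IsSpecialBipartiteMinOrdering white lt) (I : ListInstance W)
    (hmono : ∀ v, (∀ a ∈ I.list v, a ∈ white) ∨ (∀ a ∈ I.list v, a ∉ white))
    (hhom : I.HasListHom H) :
    ∃ f : Fin I.n → W, (∀ v, IsMinimumOf lt (I.arcConsistent H v) (f v)) ∧ I.IsListHom H f := by
  obtain ⟨f, hf, hl⟩ := hhom
  obtain ⟨s, hs⟩ := (isHom_iff _ _ _).1 hf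
  obtain ⟨t, ht⟩ := hbal.exists_potential hirr hconn
  have hadj : ∀ u v, I.graph.Adj u v → H.Adj (f u) (f v) := fun u v h =>
    h.exists_edge.elim fun c hc => (hs c u v hc).adj
  have hmem := I.mem_arcConsistent hadj hl
  have hmin : ∀ v, ∃ m, IsMinimumOf lt (I.arcConsistent H v) m := fun v => by
    refine hord.exists_isMinimumOf _ ⟨f v, hmem v⟩ fun a ha b hb => ?_
    have ha' := I.arcConsistent_subset v ha
    have hb' := I.arcConsistent_subset v hb
    rcases hmono v with h | h
    · exact iff_of_true (h a ha') (h b hb')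
    · exact iff_of_false (h a ha') (h b hb')
  choose m hm using hmin
  refine ⟨m, hm, (isHom_iff _ _ _).2 ⟨fun v => s v ^^ (t (f v) ^^ t (m v)), fun c u v h => ?_⟩,
    fun v => I.arcConsistent_subset v (hm v).1⟩
  have hmadj : H.Adj (m u) (m v) := hord.adj_of_isMinimumOf (hm u) (hm v)
    (I.exists_mem_arcConsistent_adj h.adj (hm u).1)
    (I.exists_mem_arcConsistent_adj h.adj.symm (hm v).1)
  have key := hord.edge_of_le hconn ht ((hm u).le (hmem u)) ((hm v).le (hmem v)) hmadj (hs c u v h)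
  rwa [xor_xor_xor_comm, Bool.xor_comm _ (s u), Bool.xor_comm _ (s v)] at key

end ArcConsistency

/-! ### Path consistency -/

/-- A binary constraint between two vertices of the input. A value `(a, s)` of a vertex consists of
its image `a` and the bit `s` that tells whether the vertex is switched. -/
abbrev PairRel (W : Type) : Type := Set ((W × Bool) × (W × Bool))

/-- The pairs of values that have a common partner with respect to `R` and `S`. -/
def PairRel.join (R S : PairRel W) : PairRel W := {p | ∃ c, (c, p.1) ∈ R ∧ (c, p.2) ∈ S}

/-- The constraint between `u` and `v` imposed by the list of `u` and by the matrix entry of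
`uv`. -/
def entryRel (H : SignedGraph W) (L : Finset W) (e : Bool × Bool) : PairRel W :=
  {p | p.1.1 ∈ L ∧ (e.1 → H.Edge (false ^^ (p.1.2 ^^ p.2.2)) p.1.1 p.2.1) ∧
    (e.2 → H.Edge (true ^^ (p.1.2 ^^ p.2.2)) p.1.1 p.2.1)}

open Classical in
/-- The constraints imposed by an instance, where a vertex is constrained to equal itself. -/
noncomputable def ListInstance.constraint (I : ListInstance W) (H : SignedGraph W)
    (u v : Fin I.n) : PairRel W :=
  entryRel H (I.list u) (decide (I.graph.pos u v), decide (I.graph.neg u v)) ∩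
    if u = v then {p | p.1 = p.2} else Set.univ

/-- One round of path consistency: a pair of values of `u` and `v` is kept if it extends to every
third vertex `w`. -/
def refine (M : V → V → PairRel W) (u v : V) : PairRel W :=
  M u v ∩ {p | ∀ w, p ∈ (M w u).join (M w v)}

theorem mem_iterate_refine (M : V → V → PairRel W) (φ : V → W × Bool)
    (h : ∀ u v, (φ u, φ v) ∈ M u v) (N : ℕ) (u v : V) : (φ u, φ v) ∈ refine^[N] M u v := by
  induction N generalizing u v with
  | zero => exact h u v
  | succ N ih =>
    rw [Function.iterate_succ_apply']
    exact ⟨ih u v, fun w => ⟨φ w, ih w u, ih w v⟩⟩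

theorem iterate_refine_subset (M : V → V → PairRel W) (N : ℕ) (u v : V) :
    refine^[N] M u v ⊆ M u v := by
  induction N with
  | zero => rfl
  | succ N ih =>
    rw [Function.iterate_succ_apply']
    exact Set.inter_subset_left.trans ih

theorem refine_iterate_fixed [Fintype V] [Fintype W] (M : V → V → PairRel W) (N : ℕ)
    (hN : Fintype.card V * Fintype.card V * Fintype.card ((W × Bool) × (W × Bool)) ≤ N) :
    refine (refine^[N] M) = refine^[N] M := by
  have hle : ∀ (M : V → V → PairRel W) u v, (refine M u v).ncard ≤ (M u v).ncard :=
    fun M u v => Set.ncard_le_ncard Set.inter_subset_left (Set.toFinite _)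
  refine iterate_fixed_of_measure (refine (V := V) (W := W)) (fun M => ∑ u, ∑ v, (M u v).ncard)
    (fun M hne => ?_) N M (le_trans ?_ hN)
  · obtain ⟨u, hu⟩ := Function.ne_iff.1 hne
    obtain ⟨v, hv⟩ := Function.ne_iff.1 hu
    exact Finset.sum_lt_sum (fun u _ => Finset.sum_le_sum fun v _ => hle M u v)
      ⟨u, Finset.mem_univ u, Finset.sum_lt_sum (fun v _ => hle M u v)
        ⟨v, Finset.mem_univ v, Set.ncard_lt_ncard
          (Set.inter_subset_left.ssubset_of_ne hv) (Set.toFinite _)⟩⟩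
  · calc ∑ u, ∑ v, (M u v).ncard
        ≤ ∑ _u : V, ∑ _v : V, Fintype.card ((W × Bool) × (W × Bool)) :=
          Finset.sum_le_sum fun u _ => Finset.sum_le_sum fun v _ => by
            rw [← Nat.card_eq_fintype_card]
            exact Set.ncard_le_card _
      _ = _ := by simp [mul_assoc]

/-- Path consistency solves systems of parity constraints. Suppose that along the edges of a
symmetric relation `E` the pairs allowed by a path consistent family `M` change the bit `ρ` in a
prescribed way `π`. Then there are bits `σ` of the vertices that are changed by the edges in this
way. They are read off from the values related to a fixed value of a root of each component; these
all have the same bit, since following a walk does not lose the value at the root. -/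
theorem exists_potential_of_refine_eq {D : Type} (M : V → V → Set (D × D))
    (hstab : ∀ u v w p, p ∈ M u v → ∃ c, (c, p.1) ∈ M w u ∧ (c, p.2) ∈ M w v)
    (hdiag : ∀ u p, p ∈ M u u → p.1 = p.2) (E : V → V → Prop) (hE : ∀ u v, E u v → E v u)
    (good : V → D → Prop) (hgood : ∀ u, ∃ d, (d, d) ∈ M u u ∧ good u d) (ρ : V → D → Bool)
    (π : V → V → Bool)
    (hstep : ∀ u v p, E u v → p ∈ M u v → good u p.1 → good v p.2 ∧ ρ v p.2 = (ρ u p.1 ^^ π u v)) :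
    ∃ σ : V → Bool, (∀ v, ∃ d, (d, d) ∈ M v v ∧ good v d ∧ ρ v d = σ v) ∧
      ∀ u v, E u v → σ v = (σ u ^^ π u v) := by
  have : Std.Symm E := ⟨hE⟩
  let S : Setoid V := ⟨Relation.ReflTransGen E, fun _ => .refl,
    fun h => Relation.ReflTransGen.stdSymm.symm _ _ h, fun h h' => h.trans h'⟩
  have hsymm : ∀ u v d e, (d, e) ∈ M u v → (e, d) ∈ M v u := fun u v d e h => by
    obtain ⟨c, hc, hc'⟩ := hstab u v v _ h
    obtain rfl : c = e := hdiag v _ hc'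
    exact hc
  have hself : ∀ u v d e, (d, e) ∈ M u v → (e, e) ∈ M v v := fun u v d e h => by
    obtain ⟨c, _, hc'⟩ := hstab u v v _ h
    obtain rfl : c = e := hdiag v _ hc'
    exact hc'
  have hne : ∀ u v d, (d, d) ∈ M u u → ∃ e, (d, e) ∈ M u v := fun u v d h => by
    obtain ⟨c, hc, _⟩ := hstab u u v _ h
    exact ⟨c, hsymm _ _ _ _ hc⟩
  choose r₀ hr₀ using fun u : V => (⟨(Quotient.mk S u).out, rfl⟩ : ∃ r, r = (Quotient.mk S u).out)
  have hroot : ∀ u, Relation.ReflTransGen E (r₀ u) u := fun u => by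
    rw [hr₀]
    exact Quotient.exact (Quotient.out_eq (Quotient.mk S u))
  have hEroot : ∀ u v, E u v → r₀ u = r₀ v := fun u v h => by
    have : Quotient.mk S u = Quotient.mk S v := Quotient.sound (.single h)
    rw [hr₀, hr₀, this]
  choose d hd hdgood using hgood
  have hconst : ∀ r u, Relation.ReflTransGen E r u →
      ∃ b, ∀ e, (d r, e) ∈ M r u → good u e ∧ ρ u e = b := by
    intro r u h
    induction h with
    | refl =>
      refine ⟨ρ r (d r), fun e he => ?_⟩
      obtain rfl : d r = e := hdiag r _ he
      exact ⟨hdgood r, rfl⟩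
    | @tail u v _ huv ih =>
      obtain ⟨b, hb⟩ := ih
      refine ⟨b ^^ π u v, fun e he => ?_⟩
      obtain ⟨c, hc, hc'⟩ := hstab r v u _ he
      obtain ⟨hg, hρ⟩ := hb c (hsymm _ _ _ _ hc)
      rw [← hρ]
      exact hstep u v _ huv hc' hg
  choose e he using fun u => hne (r₀ u) u (d (r₀ u)) (hd _)
  refine ⟨fun u => ρ u (e u), fun v => ⟨e v, hself _ _ _ _ (he v), ?_, rfl⟩, fun u v huv => ?_⟩
  · obtain ⟨b, hb⟩ := hconst _ v (hroot v)
    exact (hb _ (he v)).1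
  · obtain ⟨b, hb⟩ := hconst _ u (hroot u)
    obtain ⟨c, hc, hc'⟩ := hstab (r₀ v) v u _ (he v)
    have hcu : (d (r₀ u), c) ∈ M (r₀ u) u := by
      rw [hEroot u v huv]
      exact hsymm _ _ _ _ hc
    change ρ v (e v) = (ρ u (e u) ^^ π u v)
    rw [(hb _ (he u)).2, ← (hb _ hcu).2]
    exact (hstep u v _ huv hc' (hb _ hcu).1).2

theorem xor_eq_of_xor_eq {c y z q r : Bool} (h : (c ^^ (y ^^ z)) = (q ^^ r)) :
    (z ^^ r) = (y ^^ q ^^ c) := by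
  revert c y z q r
  decide

theorem xor_cancel_potential (c x y z : Bool) :
    (c ^^ (z ^^ x ^^ (z ^^ c ^^ y))) = (x ^^ y) := by
  revert c x y z
  decide

/-- A constraint network that survives path consistency has a solution: after a colour has been
chosen for each component of the input, the minima of the remaining values of that colour form a
homomorphism of underlying graphs, and the signs of the edges with unicoloured images are
consistent because every value of the right colour gives them a unicoloured image. -/
theorem ListInstance.hasListHom_of_refine_eq {H : SignedGraph W} {white : Set W}
    {lt : W → W → Prop} [Fintype W] (hirr : H.Irreflexive) (hbal : H.UniBalanced)
    (hconn : H.uniGraph.Connected) (hord : H.IsSpecialBipartiteMinOrdering white lt)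
    (I : ListInstance W) (M : Fin I.n → Fin I.n → PairRel W)
    (hM : ∀ u v, M u v ⊆ I.constraint H u v) (hfix : refine M = M)
    (hne : ∀ u v, (M u v).Nonempty) : I.HasListHom H := by
  classical
  obtain ⟨t, ht⟩ := hbal.exists_potential hirr hconn
  have hstab : ∀ u v w p, p ∈ M u v → ∃ c, (c, p.1) ∈ M w u ∧ (c, p.2) ∈ M w v := by
    intro u v w p hp
    rw [← hfix] at hp
    exact hp.2 w
  have hdiag : ∀ u p, p ∈ M u u → p.1 = p.2 := fun u p hp => by
    have h := (hM u u hp).2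
    rwa [if_pos rfl] at h
  have hlist : ∀ u d, (d, d) ∈ M u u → d.1 ∈ I.list u := fun u d h => (hM u u h).1.1
  have hedge : ∀ c u v p, I.graph.Edge c u v → p ∈ M u v →
      H.Edge (c ^^ (p.1.2 ^^ p.2.2)) p.1.1 p.2.1 := fun c u v p h hp => by
    have h' := (hM u v hp).1.2
    cases c
    · exact h'.1 (decide_eq_true h)
    · exact h'.2 (decide_eq_true h)
  have hadj : ∀ u v p, I.graph.Adj u v → p ∈ M u v → H.Adj p.1.1 p.2.1 := fun u v p h hp =>
    h.exists_edge.elim fun c hc => (hedge c u v p hc hp).adj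
  have hex : ∀ u, ∃ d, (d, d) ∈ M u u := fun u => by
    obtain ⟨⟨d, e⟩, h⟩ := hne u u
    obtain rfl : d = e := hdiag u _ h
    exact ⟨d, h⟩
  -- Path consistency in the case of two equal vertices.
  have hsupp : ∀ u v d, (d, d) ∈ M u u → ∃ e, (e, e) ∈ M v v ∧ (e, d) ∈ M v u := fun u v d h => by
    obtain ⟨e, he, _⟩ := hstab u u v _ h
    obtain ⟨c, hc, _⟩ := hstab v u v _ he
    obtain rfl : c = e := hdiag v _ hc
    exact ⟨c, hc, he⟩
  have hcolour : ∀ {x y : W}, H.Adj x y → decide (y ∈ white) = !decide (x ∈ white) :=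
    fun h => hord.decide_mem_white h
  -- The colours of the images.
  obtain ⟨κ, hκ, hκE⟩ := exists_potential_of_refine_eq M hstab hdiag I.graph.Adj
    (fun _ _ h => h.symm) (fun _ _ => True) (fun u => (hex u).imp fun _ h => ⟨h, trivial⟩)
    (fun _ d => decide (d.1 ∈ white)) (fun _ _ => true) (fun u v p h hp _ => by
      exact ⟨trivial, (hcolour (hadj u v p h hp)).trans (Bool.xor_true _).symm⟩)
  -- The values of the right colour, and their minima.
  let L : Fin I.n → Finset W := fun u =>
    Finset.univ.filter fun a => decide (a ∈ white) = κ u ∧ ∃ s, ((a, s), (a, s)) ∈ M u u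
  have hL : ∀ u d, (d, d) ∈ M u u → decide (d.1 ∈ white) = κ u → d.1 ∈ L u := fun u d h hc =>
    Finset.mem_filter.2 ⟨Finset.mem_univ _, hc, d.2, h⟩
  have hmin : ∀ u, ∃ m, IsMinimumOf lt (L u) m := fun u => by
    obtain ⟨d, hd, -, hc⟩ := hκ u
    refine hord.exists_isMinimumOf _ ⟨d.1, hL u d hd hc⟩ fun a ha b hb => ?_
    have ha' := (Finset.mem_filter.1 ha).2.1
    have hb' := (Finset.mem_filter.1 hb).2.1
    rw [← hb'] at ha'
    simpa using ha'
  choose m hm using hmin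
  have hLadj : ∀ u v, I.graph.Adj u v → ∀ a ∈ L u, ∃ b ∈ L v, H.Adj a b := by
    intro u v huv a ha
    obtain ⟨-, hc, s, hs⟩ := Finset.mem_filter.1 ha
    obtain ⟨e, he, he'⟩ := hsupp u v _ hs
    have hadj' : H.Adj e.1 a := hadj v u _ huv.symm he'
    refine ⟨e.1, hL v e he ?_, hadj'.symm⟩
    rw [hκE u v huv, ← hc, Bool.xor_true]
    exact hcolour hadj'.symm
  have hmadj : ∀ u v, I.graph.Adj u v → H.Adj (m u) (m v) := fun u v huv =>
    hord.adj_of_isMinimumOf (hm u) (hm v) (hLadj u v huv _ (hm u).1)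
      (hLadj v u huv.symm _ (hm v).1)
  -- The signs of the edges whose images are unicoloured.
  have hpair : ∀ u v p, I.graph.Adj u v → H.Unicoloured (m u) (m v) → p ∈ M u v → p.1.1 ∈ L u →
      p.2.1 ∈ L v ∧ ∀ c, I.graph.Edge c u v → (c ^^ (p.1.2 ^^ p.2.2)) = (t p.1.1 ^^ t p.2.1) := by
    intro u v p h huni hp hg
    have hadj' := hadj u v p h hp
    have hpp : (p.2, p.2) ∈ M v v := by
      obtain ⟨c, _, hc⟩ := hstab u v v _ hp
      have : c = p.2 := hdiag v _ hc
      rwa [this] at hc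
    have hg' : p.2.1 ∈ L v := by
      refine hL v _ hpp ?_
      rw [hκE u v h, ← (Finset.mem_filter.1 hg).2.1]
      exact (hcolour hadj').trans (Bool.xor_true _).symm
    have huni : H.Unicoloured p.1.1 p.2.1 := ⟨hadj', hord.not_bicoloured_of_le hconn
      ((hm u).le hg) ((hm v).le hg') huni⟩
    exact ⟨hg', fun c hc => (ht _ _ _ huni).1 (hedge c u v p hc hp)⟩
  -- The preimage of a unicoloured edge has only one sign.
  have hsign : ∀ c u v, I.graph.Edge c u v → H.Unicoloured (m u) (m v) →
      c = decide (I.graph.neg u v) := by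
    intro c u v h huni
    obtain ⟨d, hd, -, hc⟩ := hκ u
    obtain ⟨e, he, _⟩ := hstab u u v _ hd
    obtain ⟨x, hx, hx'⟩ := hstab v u u _ he
    obtain rfl : x = d := hdiag u _ hx'
    have key := (hpair u v _ h.adj huni hx (hL u x hd hc)).2
    by_cases hn : I.graph.neg u v
    · rw [decide_eq_true hn]
      exact Bool.xor_left_inj.1 ((key c h).trans (key true hn).symm)
    · rw [decide_eq_false hn]
      cases c
      · rfl
      · exact absurd h hn
  obtain ⟨σ, -, hσ⟩ := exists_potential_of_refine_eq M hstab hdiag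
    (fun u v => I.graph.Adj u v ∧ H.Unicoloured (m u) (m v)) (fun _ _ h => ⟨h.1.symm, h.2.symm⟩)
    (fun u d => d.1 ∈ L u)
    (fun u => by
      obtain ⟨d, hd, -, hc⟩ := hκ u
      exact ⟨d, hd, hL u d hd hc⟩)
    (fun _ d => d.2 ^^ t d.1) (fun u v => decide (I.graph.neg u v))
    (fun u v p h hp hg => by
      obtain ⟨hg', key⟩ := hpair u v p h.1 h.2 hp hg
      obtain ⟨c, hc⟩ := h.1.exists_edge
      refine ⟨hg', ?_⟩
      rw [← hsign c u v hc h.2]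
      exact xor_eq_of_xor_eq (key c hc))
  refine ⟨m, (isHom_iff _ _ _).2 ⟨fun v => σ v ^^ t (m v), fun c u v h => ?_⟩, fun v => ?_⟩
  · by_cases hb : H.Bicoloured (m u) (m v)
    · exact hb.edge _
    · have huni : H.Unicoloured (m u) (m v) := ⟨hmadj u v h.adj, hb⟩
      rw [ht _ _ _ huni]
      beta_reduce
      rw [hσ u v ⟨h.adj, huni⟩, ← hsign c u v h huni]
      exact xor_cancel_potential _ _ _ _
  · obtain ⟨-, -, s, hs⟩ := Finset.mem_filter.1 (hm v).1
    exact hlist v _ hs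

/-- Path consistency decides the list homomorphism problem. -/
theorem ListInstance.hasListHom_iff_nonempty {H : SignedGraph W} {white : Set W}
    {lt : W → W → Prop} [Fintype W] (hirr : H.Irreflexive) (hbal : H.UniBalanced)
    (hconn : H.uniGraph.Connected) (hord : H.IsSpecialBipartiteMinOrdering white lt)
    (I : ListInstance W) (N : ℕ)
    (hN : I.n * I.n * Fintype.card ((W × Bool) × (W × Bool)) ≤ N) :
    I.HasListHom H ↔ ∀ u v, (refine^[N] (I.constraint H) u v).Nonempty := by
  classical
  constructor
  · rintro ⟨f, hf, hl⟩ u v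
    obtain ⟨s, hs⟩ := (isHom_iff _ _ _).1 hf
    have key : ∀ u v, ((f u, s u), (f v, s v)) ∈ I.constraint H u v := by
      refine fun u v => ⟨⟨hl u, fun h => hs false u v (of_decide_eq_true h),
        fun h => hs true u v (of_decide_eq_true h)⟩, ?_⟩
      split_ifs with h
      · subst h; rfl
      · trivial
    exact ⟨_, mem_iterate_refine _ (fun v => (f v, s v)) key N u v⟩
  · exact I.hasListHom_of_refine_eq hirr hbal hconn hord _ (iterate_refine_subset _ N)
      (refine_iterate_fixed _ N (by simpa using hN))

/-! ### A machine for path consistency: stacks, registers and loops -/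

namespace PathMachine

open StackProg

/-- The work stacks. The matrix of constraints is stored row by row on `mat`, and passes through
`buf` when it is processed; `src` holds the matrix from which the rows for the current round are
taken, and `outer` and `inner` (with `innerBuf`) hold such a row. The stack `diag` (with `diagBuf`)
has one symbol for each vertex of the input; it is used to mark the diagonal of the matrix and to
measure rows. The stacks `rows` and `fuel` are counters. -/
inductive Track : Type
  | mat | buf | src | outer | inner | innerBuf | diag | diagBuf | rows | fuel
  deriving DecidableEq

instance : Fintype Track :=
  ⟨{.mat, .buf, .src, .outer, .inner, .innerBuf, .diag, .diagBuf, .rows, .fuel}, fun i => by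
    cases i <;> decide⟩

/-- The stacks of the machine. -/
inductive Stack : Type
  | inp
  | out
  | work (i : Track)
  deriving DecidableEq, Fintype

variable (W) in
/-- The stack alphabets. -/
abbrev Alphabet : Stack → Type
  | .inp => InputSymbol W
  | .out => Bool
  | .work _ => PairRel W

noncomputable instance [Fintype W] : ∀ k, Fintype (Alphabet W k)
  | .inp => inferInstanceAs (Fintype (InputSymbol W))
  | .out => inferInstanceAs (Fintype Bool)
  | .work _ => Fintype.ofFinite (PairRel W)

variable (W) in
/-- The finite register of the machine: the result `more` of the last loop test, a flag `hdr`, the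
answer `ok`, the list `list` of the current row of the input, and three matrix entries. -/
structure Reg : Type where
  more : Bool
  hdr : Bool
  ok : Bool
  list : Finset W
  p : PairRel W
  x : PairRel W
  y : PairRel W

noncomputable instance [Fintype W] : Fintype (Reg W) :=
  haveI : Finite (Reg W) := Finite.of_injective
    (fun r => (r.more, r.hdr, r.ok, r.list, r.p, r.x, r.y)) fun r s h => by
      cases r; cases s; simpa using h
  Fintype.ofFinite _

/-- The initial and final contents of the register. -/
def reset : Reg W := ⟨false, false, true, ∅, ∅, ∅, ∅⟩

variable (W) in
/-- The contents of all stacks. -/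
structure Mem : Type where
  inp : List (InputSymbol W) := []
  out : List Bool := []
  mat : List (PairRel W) := []
  buf : List (PairRel W) := []
  src : List (PairRel W) := []
  outer : List (PairRel W) := []
  inner : List (PairRel W) := []
  innerBuf : List (PairRel W) := []
  diag : List (PairRel W) := []
  diagBuf : List (PairRel W) := []
  rows : List (PairRel W) := []
  fuel : List (PairRel W) := []

/-- The stack contents as a function, as required by the machine model. -/
def Mem.get (m : Mem W) : ∀ k, List (Alphabet W k)
  | .inp => m.inp
  | .out => m.out
  | .work .mat => m.mat
  | .work .buf => m.buf
  | .work .src => m.src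
  | .work .outer => m.outer
  | .work .inner => m.inner
  | .work .innerBuf => m.innerBuf
  | .work .diag => m.diag
  | .work .diagBuf => m.diagBuf
  | .work .rows => m.rows
  | .work .fuel => m.fuel

section Update

variable (m : Mem W)

@[simp] theorem update_inp (l : List (InputSymbol W)) :
    Function.update m.get .inp l = { m with inp := l }.get := by
  funext k; rcases k with _ | _ | _ | _ <;> rfl

@[simp] theorem update_out (l : List Bool) :
    Function.update m.get .out l = { m with out := l }.get := by
  funext k; rcases k with _ | _ | _ | _ <;> rfl

variable (l : List (PairRel W))

@[simp] theorem update_mat :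
    Function.update m.get (.work .mat) l = { m with mat := l }.get := by
  funext k; rcases k with _ | _ | _ | _ <;> rfl

@[simp] theorem update_buf :
    Function.update m.get (.work .buf) l = { m with buf := l }.get := by
  funext k; rcases k with _ | _ | _ | _ <;> rfl

@[simp] theorem update_src :
    Function.update m.get (.work .src) l = { m with src := l }.get := by
  funext k; rcases k with _ | _ | _ | _ <;> rfl

@[simp] theorem update_outer :
    Function.update m.get (.work .outer) l = { m with outer := l }.get := by
  funext k; rcases k with _ | _ | _ | _ <;> rfl

@[simp] theorem update_inner :
    Function.update m.get (.work .inner) l = { m with inner := l }.get := by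
  funext k; rcases k with _ | _ | _ | _ <;> rfl

@[simp] theorem update_innerBuf :
    Function.update m.get (.work .innerBuf) l = { m with innerBuf := l }.get := by
  funext k; rcases k with _ | _ | _ | _ <;> rfl

@[simp] theorem update_diag :
    Function.update m.get (.work .diag) l = { m with diag := l }.get := by
  funext k; rcases k with _ | _ | _ | _ <;> rfl

@[simp] theorem update_diagBuf :
    Function.update m.get (.work .diagBuf) l = { m with diagBuf := l }.get := by
  funext k; rcases k with _ | _ | _ | _ <;> rfl

@[simp] theorem update_rows :
    Function.update m.get (.work .rows) l = { m with rows := l }.get := by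
  funext k; rcases k with _ | _ | _ | _ <;> rfl

@[simp] theorem update_fuel :
    Function.update m.get (.work .fuel) l = { m with fuel := l }.get := by
  funext k; rcases k with _ | _ | _ | _ <;> rfl

end Update

variable (W) in
/-- Programs of the machine. -/
abbrev Program : Type := Prog (Alphabet W) (Reg W)

/-- The loop that empties the stack `k` and runs `body` for each symbol; `set` stores the symbol in
the register before the body, and `done` changes the register at the end. -/
def forEach (k : Stack) (set : Reg W → Alphabet W k → Reg W) (done : Reg W → Reg W)
    (body : Program W) : Program W :=
  .loop [.pop k fun r o => o.elim { done r with more := false }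
    fun a => { set r a with more := true }] Reg.more body

theorem forEach_nil {k : Stack} {set : Reg W → Alphabet W k → Reg W} {done : Reg W → Reg W}
    {body : Program W} {r : Reg W} {S : ∀ k, List (Alphabet W k)} (h : S k = []) :
    RunsIn (forEach k set done body) (r, S) 1 ({ done r with more := false }, S) := by
  have e : Function.update S k [] = S := by rw [← h, Function.update_eq_self]
  have key := RunsIn.loop_done (ops := [Op.pop k fun r o => o.elim { done r with more := false }
    fun a => { set r a with more := true }]) (test := Reg.more) (body := body) (s := (r, S))
    (by simp [runOps, Op.run, h])
  simpa [runOps, Op.run, h, e] using! key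

theorem forEach_cons {k : Stack} {set : Reg W → Alphabet W k → Reg W} {done : Reg W → Reg W}
    {body : Program W} {r : Reg W} {S : ∀ k, List (Alphabet W k)} {a : Alphabet W k}
    {l : List (Alphabet W k)} {s' s'' : Store (Alphabet W) (Reg W)} {t t' : ℕ} (h : S k = a :: l)
    (hb : RunsIn body ({ set r a with more := true }, Function.update S k l) t s')
    (hl : RunsIn (forEach k set done body) s' t' s'') :
    RunsIn (forEach k set done body) (r, S) (1 + t + t') s'' := by
  refine RunsIn.loop_step ?_ (?_ : RunsIn body _ t s') hl
  · simp [runOps, Op.run, h]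
  · simpa [runOps, Op.run, h] using hb

theorem act_runs {ops : List (Op (Alphabet W) (Reg W))} {s s' : Store (Alphabet W) (Reg W)}
    (h : runOps ops s = s') : RunsIn (.act ops) s 1 s' :=
  h ▸ RunsIn.act ops s

/-- Moves the contents of a work stack to another one, which reverses their order. -/
def move (i j : Track) : Program W :=
  forEach (.work i) (fun r a => { r with x := a }) (fun _ => reset) (.act
    [.push (.work j) Reg.x])

theorem move_runs {i j : Track} (hij : i ≠ j) (r : Reg W) (S : ∀ k, List (Alphabet W k)) :
    RunsIn (move i j) (r, S) (2 * (S (.work i)).length + 1)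
      (reset, Function.update (Function.update S (.work i) []) (.work j)
        ((S (.work i)).reverse ++ S (.work j))) := by
  have hk : Stack.work j ≠ Stack.work i := fun h => hij (Stack.work.inj h).symm
  generalize hl : S (.work i) = l
  induction l generalizing r S with
  | nil =>
    have e : Function.update S (.work i) [] = S := by
      rw [← hl]
      exact Function.update_eq_self _ _
    refine (forEach_nil hl).cast (by simp) ?_
    rw [e]
    simp [reset]
  | cons a l ih =>
    have key := ih { r with x := a, more := true }
      (Function.update (Function.update S (.work i) l) (.work j) (a :: S (.work j)))
      (by rw [Function.update_of_ne hk.symm, Function.update_self])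
    refine (forEach_cons hl (act_runs ?_) key).cast
      (by simp only [List.length_cons]; omega) ?_
    · simp [runOps, Op.run, hk]
    · refine Prod.ext rfl (funext fun k => ?_)
      by_cases h1 : k = .work j
      · subst h1; simp
      · by_cases h2 : k = .work i
        · subst h2; simp [h1]
        · simp [h1, h2]

/-! ### A machine for path consistency: one round -/

/-- The matrix `M`, row by row, for the list `l` of indices. -/
def word {ι : Type} (l : List ι) (M : ι → ι → PairRel W) : List (PairRel W) :=
  l.flatMap fun u => l.map (M u)

theorem length_word {ι : Type} (l : List ι) (M : ι → ι → PairRel W) :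
    (word l M).length = l.length * l.length := by
  simp [word, List.length_flatMap]

/-- Empties a work stack. -/
def clear (i : Track) : Program W :=
  forEach (.work i) (fun r _ => r) (fun _ => reset) (.act [])

theorem clear_runs (i : Track) (r : Reg W) (S : ∀ k, List (Alphabet W k)) :
    RunsIn (clear i) (r, S) (2 * (S (.work i)).length + 1)
      (reset, Function.update S (.work i) []) := by
  generalize hl : S (.work i) = l
  induction l generalizing r S with
  | nil =>
    refine (forEach_nil hl).cast (by simp) ?_
    rw [← hl, Function.update_eq_self]
    rfl
  | cons a l ih =>
    have key := ih { r with more := true } (Function.update S (.work i) l)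
      (by rw [Function.update_self])
    refine (forEach_cons hl (act_runs rfl) key).cast (by simp only [List.length_cons]; omega) ?_
    rw [Function.update_idem]

/-- Moves the matrix to `buf` and to `src`, which reverses its order. -/
def copy : Program W :=
  forEach (.work .mat) (fun r a => { r with x := a }) (fun _ => reset)
    (.act [.push (.work .buf) Reg.x, .push (.work .src) Reg.x])

theorem copy_runs (xs : List (PairRel W)) (m : Mem W) (r : Reg W) :
    RunsIn copy (r, { m with mat := xs }.get) (2 * xs.length + 1)
      (reset, { m with
        mat := [], buf := xs.reverse ++ m.buf, src := xs.reverse ++ m.src }.get) := by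
  induction xs generalizing m r with
  | nil => exact (forEach_nil rfl).cast (by simp) rfl
  | cons a l ih =>
    refine (forEach_cons rfl (act_runs ?_) (ih { m with buf := a :: m.buf, src := a :: m.src }
      { r with x := a, more := true })).cast (by simp only [List.length_cons]; omega) (by simp)
    simp [runOps, Op.run, Mem.get]

/-- Moves one row from `src` to `outer` and `inner`; its length is that of `diag`. -/
def loadRow : Program W :=
  forEach (.work .diag) (fun r a => { r with x := a }) (fun _ => reset)
    (.act [.pop (.work .src) fun r o => { r with y := o.getD ∅ }, .push (.work .outer) Reg.y,
      .push (.work .inner) Reg.y, .push (.work .diagBuf) Reg.x])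

theorem loadRow_runs (ys rest : List (PairRel W)) (m : Mem W) (r : Reg W) :
    RunsIn loadRow
      (r, { m with diag := List.replicate ys.length Set.univ, src := ys ++ rest }.get)
      (2 * ys.length + 1)
      (reset, { m with
        diag := [], src := rest, outer := ys.reverse ++ m.outer, inner := ys.reverse ++ m.inner,
        diagBuf := List.replicate ys.length Set.univ ++ m.diagBuf }.get) := by
  induction ys generalizing m r with
  | nil => exact (forEach_nil rfl).cast (by simp) rfl
  | cons a l ih =>
    refine (forEach_cons rfl (act_runs ?_) (ih { m with
      outer := a :: m.outer, inner := a :: m.inner, diagBuf := Set.univ :: m.diagBuf }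
      { r with x := Set.univ, y := a, more := true })).cast
      (by simp only [List.length_cons]; omega) ?_
    · simp [runOps, Op.run, Mem.get]
    · simp [List.replicate_succ']

/-- Intersects one row of the matrix with the joins of the relation `p` and the entries of the row
on `inner`. -/
def joinRow : Program W :=
  forEach (.work .inner) (fun r a => { r with y := a }) (fun _ => reset)
    (.act [.pop (.work .mat) fun r o => { r with x := o.getD ∅ },
      .push (.work .buf) fun r => r.x ∩ r.p.join r.y, .push (.work .innerBuf) Reg.y])

theorem joinRow_runs {ι : Type} (l : List ι) (M R : ι → PairRel W) (rest : List (PairRel W))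
    (m : Mem W) (r : Reg W) :
    RunsIn joinRow (r, { m with mat := l.map M ++ rest, inner := l.map R }.get) (2 * l.length + 1)
      (reset, { m with
        mat := rest, inner := [], buf := (l.map fun v => M v ∩ r.p.join (R v)).reverse ++ m.buf,
        innerBuf := (l.map R).reverse ++ m.innerBuf }.get) := by
  induction l generalizing m r with
  | nil => exact (forEach_nil rfl).cast (by simp) rfl
  | cons a l ih =>
    refine (forEach_cons rfl (act_runs ?_) (ih { m with
      buf := (M a ∩ r.p.join (R a)) :: m.buf, innerBuf := R a :: m.innerBuf }
      { r with x := M a, y := R a, more := true })).cast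
      (by simp only [List.length_cons]; omega) (by simp)
    simp [runOps, Op.run, Mem.get]

/-- Intersects the matrix with the joins of the entries of the row on `outer` and `inner`. -/
def joinRows : Program W :=
  forEach (.work .outer) (fun r a => { r with p := a }) (fun _ => reset)
    (.seq joinRow (move .innerBuf .inner))

theorem joinRows_runs {ι : Type} (us vs : List ι) (M : ι → ι → PairRel W) (R : ι → PairRel W)
    (m : Mem W) (r : Reg W) :
    RunsIn joinRows
      (r, { m with
        mat := us.flatMap fun u => vs.map (M u), outer := us.map R, inner := vs.map R,
        innerBuf := [] }.get)
      (us.length * (4 * vs.length + 3) + 1)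
      (reset, { m with
        mat := [], outer := [], inner := vs.map R, innerBuf := [],
        buf := (us.flatMap fun u => vs.map fun v => M u v ∩ (R u).join (R v)).reverse ++
          m.buf }.get) := by
  induction us generalizing m r with
  | nil => exact (forEach_nil rfl).cast (by simp) rfl
  | cons u us ih =>
    have h1 := joinRow_runs vs (M u) R (us.flatMap fun u => vs.map (M u))
      { m with outer := us.map R, innerBuf := [] } { r with p := R u, more := true }
    have h2 := move_runs (W := W) (i := .innerBuf) (j := .inner) (by decide) reset { m with
      mat := us.flatMap fun u => vs.map (M u), outer := us.map R, inner := [],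
      innerBuf := (vs.map R).reverse,
      buf := (vs.map fun v => M u v ∩ (R u).join (R v)).reverse ++ m.buf }.get
    simp only [Mem.get, update_innerBuf, update_inner, List.reverse_reverse, List.append_nil] at h2
    simp only [List.append_nil] at h1
    have h3 := ih { m with
      buf := (vs.map fun v => M u v ∩ (R u).join (R v)).reverse ++ m.buf } reset
    refine (forEach_cons rfl (t := 4 * vs.length + 2) ?_ h3).cast ?_ (by simp)
    · refine (RunsIn.seq (by simpa using! h1) h2).mono ?_
      simp only [List.length_reverse, List.length_map]
      omega
    · simp only [List.length_cons]
      ring_nf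
      omega

/-- Intersects the matrix with the joins of the entries of the next row on `src`. -/
def pivot : Program W :=
  .seq loadRow (.seq (move .diagBuf .diag) (.seq joinRows (.seq (move .buf .mat) (clear .inner))))

theorem pivot_runs {ι : Type} (l : List ι) (M : ι → ι → PairRel W) (R : ι → PairRel W)
    (rest fuel : List (PairRel W)) (r : Reg W) :
    RunsIn pivot
      (r, { mat := word l M, src := (l.map R).reverse ++ rest,
            diag := List.replicate l.length Set.univ, fuel := fuel : Mem W }.get)
      (6 * l.length ^ 2 + 9 * l.length + 5)
      (reset, { mat := word l fun u v => M u v ∩ (R u).join (R v), src := rest,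
                diag := List.replicate l.length Set.univ, fuel := fuel : Mem W }.get) := by
  have h1 := loadRow_runs (l.map R).reverse rest { mat := word l M, fuel := fuel } r
  have h2 := move_runs (W := W) (i := .diagBuf) (j := .diag) (by decide) reset
    { mat := word l M, src := rest, outer := l.map R, inner := l.map R, fuel := fuel,
      diagBuf := List.replicate l.length Set.univ : Mem W }.get
  have h3 := joinRows_runs l l M R
    { src := rest, diag := List.replicate l.length Set.univ, fuel := fuel } reset
  have h4 := move_runs (W := W) (i := .buf) (j := .mat) (by decide) reset
    { src := rest, inner := l.map R, diag := List.replicate l.length Set.univ, fuel := fuel,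
      buf := (word l fun u v => M u v ∩ (R u).join (R v)).reverse : Mem W }.get
  have h5 := clear_runs (W := W) .inner reset
    { src := rest, inner := l.map R, diag := List.replicate l.length Set.univ, fuel := fuel,
      mat := word l fun u v => M u v ∩ (R u).join (R v) : Mem W }.get
  simp [Mem.get] at h1 h2 h3 h4 h5
  refine (h1.seq (h2.seq (h3.seq (h4.seq h5)))).mono ?_
  rw [length_word]
  ring_nf
  omega

/-- One round of path consistency. -/
def round : Program W :=
  .seq copy (.seq (move .buf .mat)
    (.loop [.peek (.work .src) fun _ o => { reset with more := o.isSome }] Reg.more pivot))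

/-- The rows `ws` of `R`, which lie reversed on `src`, are used one after the other. -/
theorem pivots_runs {ι : Type} (l ws : List ι) (hws : ws ⊆ l) (M R : ι → ι → PairRel W)
    (fuel : List (PairRel W)) (r : Reg W) :
    RunsIn (.loop [.peek (.work .src) fun _ o => { reset with more := o.isSome }] Reg.more pivot)
      (r, { mat := word l M, src := ws.flatMap fun w => (l.map (R w)).reverse,
            diag := List.replicate l.length Set.univ, fuel := fuel : Mem W }.get)
      (ws.length * (6 * l.length ^ 2 + 9 * l.length + 6) + 1)
      (reset, { mat := word l fun u v => M u v ∩ {p | ∀ w ∈ ws, p ∈ (R w u).join (R w v)},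
                diag := List.replicate l.length Set.univ, fuel := fuel : Mem W }.get) := by
  induction ws generalizing M r with
  | nil =>
    refine (RunsIn.loop_done ?_).cast (by simp) ?_
    · simp [runOps, Op.run, Mem.get]
    · simp [runOps, Op.run, Mem.get, reset]
  | cons w ws ih =>
    rw [List.cons_subset] at hws
    obtain ⟨a, l', hal⟩ : ∃ a l', (l.map (R w)).reverse = a :: l' :=
      List.exists_cons_of_ne_nil fun h => by simp at h; simp [h] at hws
    have h1 := pivot_runs l M (R w) (ws.flatMap fun w => (l.map (R w)).reverse) fuel
      { reset with more := true }
    have h2 := ih hws.2 (fun u v => M u v ∩ (R w u).join (R w v)) reset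
    refine (RunsIn.loop_step (t := 6 * l.length ^ 2 + 9 * l.length + 5) ?_ ?_ h2).cast ?_ ?_
    · simp [runOps, Op.run, Mem.get, hal]
    · simpa [runOps, Op.run, Mem.get, hal] using! h1
    · simp only [List.length_cons]
      ring_nf
      omega
    · congr 4
      funext u v
      ext p
      simp [and_assoc]

/-- The rows used in a round are those of the matrix at the beginning of the round, so that the
round computes `refine`. -/
theorem round_runs {ι : Type} (l : List ι) (hl : ∀ u, u ∈ l) (M : ι → ι → PairRel W)
    (fuel : List (PairRel W)) (r : Reg W) :
    RunsIn round
      (r, { mat := word l M, diag := List.replicate l.length Set.univ, fuel := fuel : Mem W }.get)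
      (6 * l.length ^ 3 + 13 * l.length ^ 2 + 6 * l.length + 3)
      (reset, { mat := word l (refine M), diag := List.replicate l.length Set.univ,
                fuel := fuel : Mem W }.get) := by
  have h1 := copy_runs (word l M) { diag := List.replicate l.length Set.univ, fuel := fuel } r
  have h2 := move_runs (W := W) (i := .buf) (j := .mat) (by decide) reset
    { diag := List.replicate l.length Set.univ, fuel := fuel, buf := (word l M).reverse,
      src := (word l M).reverse : Mem W }.get
  have h3 := pivots_runs l l.reverse (by simp) M M fuel reset
  have hrev : (l.reverse.flatMap fun w => (l.map (M w)).reverse) = (word l M).reverse := by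
    rw [word, List.reverse_flatMap]
    rfl
  rw [hrev] at h3
  simp [Mem.get] at h1 h2 h3
  have hM : (fun u v => M u v ∩ {p | ∀ w ∈ l, p ∈ (M w u).join (M w v)}) = refine M := by
    funext u v
    simp [refine, hl]
  rw [hM] at h3
  refine (h1.seq (h2.seq h3)).mono ?_
  rw [length_word]
  ring_nf
  omega

/-- Runs one round of path consistency for each symbol on `fuel`. -/
def rounds : Program W :=
  forEach (.work .fuel) (fun r _ => r) (fun _ => reset) round

theorem rounds_runs {ι : Type} (l : List ι) (hl : ∀ u, u ∈ l) (M : ι → ι → PairRel W) (N : ℕ)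
    (r : Reg W) :
    RunsIn rounds
      (r, { mat := word l M, diag := List.replicate l.length Set.univ,
            fuel := List.replicate N ∅ : Mem W }.get)
      (N * (6 * l.length ^ 3 + 13 * l.length ^ 2 + 6 * l.length + 4) + 1)
      (reset, { mat := word l (refine^[N] M),
                diag := List.replicate l.length Set.univ : Mem W }.get) := by
  induction N generalizing M r with
  | zero => exact (forEach_nil rfl).cast (by simp) rfl
  | succ N ih =>
    have h1 := round_runs l hl M (List.replicate N ∅) { r with more := true }
    refine (forEach_cons rfl (t := 6 * l.length ^ 3 + 13 * l.length ^ 2 + 6 * l.length + 3) ?_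
      (ih (refine M) reset)).cast ?_ rfl
    · simpa using! h1
    · ring_nf
      omega

/-! ### A machine for path consistency: input and output -/

/-- Reads the input. The constraints imposed by the matrix entries are stored on `buf`, in reverse
order; every symbol contributes `k` units of fuel, and every row contributes one symbol to `rows`
and to `diag`. -/
noncomputable def readInput (H : SignedGraph W) (k : ℕ) : Program W :=
  forEach .inp
    (fun r a => a.elim (fun L => { r with list := L, hdr := true })
      fun e => { r with x := entryRel H r.list e, hdr := false })
    (fun _ => reset)
    (.act (List.replicate k (.push (.work .fuel) fun _ => ∅) ++
      [.when Reg.hdr (.push (.work .rows) fun _ => ∅),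
        .when Reg.hdr (.push (.work .diag) fun _ => Set.univ),
        .when (fun r => !r.hdr) (.push (.work .buf) Reg.x),
        .load fun r => { reset with list := r.list }]))

theorem runOps_append (ops ops' : List (Op (Alphabet W) (Reg W)))
    (s : Store (Alphabet W) (Reg W)) : runOps (ops ++ ops') s = runOps ops' (runOps ops s) := by
  induction ops generalizing s with
  | nil => rfl
  | cons op ops ih => exact ih _

theorem runOps_replicate_fuel (k : ℕ) (r : Reg W) (m : Mem W) :
    runOps (List.replicate k (.push (.work .fuel) fun _ => ∅)) (r, m.get) =
      (r, { m with fuel := List.replicate k ∅ ++ m.fuel }.get) := by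
  induction k generalizing m with
  | zero => rfl
  | succ k ih =>
    rw [List.replicate_succ, runOps, Op.run]
    simp only [update_fuel, Mem.get]
    rw [ih, List.replicate_succ']
    simp

/-- Reading the entries `es` of a row with the list `L`, in front of any continuation. -/
theorem readInput_entries (H : SignedGraph W) (k : ℕ) (L : Finset W) (es : List (Bool × Bool))
    (rest : List (InputSymbol W)) (m : Mem W) (t : ℕ) (s : Store (Alphabet W) (Reg W))
    (h : RunsIn (readInput H k) ({ reset with list := L }, { m with
      inp := rest, buf := (es.map (entryRel H L)).reverse ++ m.buf,
      fuel := List.replicate (k * es.length) ∅ ++ m.fuel }.get) t s) :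
    RunsIn (readInput H k) ({ reset with list := L }, { m with inp := es.map Sum.inr ++ rest }.get)
      (2 * es.length + t) s := by
  induction es generalizing m with
  | nil => simpa using! h
  | cons e es ih =>
    have h1 := ih { m with
      buf := entryRel H L e :: m.buf, fuel := List.replicate k ∅ ++ m.fuel } (by
        have hf : List.replicate (k * (e :: es).length) (∅ : PairRel W) =
            List.replicate (k * es.length) ∅ ++ List.replicate k ∅ := by
          rw [List.length_cons, mul_add_one, List.replicate_add]
        rw [hf] at h
        simpa only [List.map_cons, List.reverse_cons, List.append_assoc, List.singleton_append]
          using! h)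
    refine (forEach_cons rfl (act_runs ?_) h1).mono (by simp only [List.length_cons]; omega)
    simp only [List.append_eq, update_inp, runOps_append, runOps_replicate_fuel]
    simp [runOps, Op.run, Mem.get]

theorem readInput_runs {ι : Type} (H : SignedGraph W) (k : ℕ) (us vs : List ι) (L : ι → Finset W)
    (e : ι → ι → Bool × Bool) (m : Mem W) (r : Reg W) :
    RunsIn (readInput H k)
      (r, { m with
        inp := us.flatMap fun u => Sum.inl (L u) :: vs.map fun v => Sum.inr (e u v) }.get)
      (2 * (us.length * (vs.length + 1)) + 1)
      (reset, { m with
        inp := [], rows := List.replicate us.length ∅ ++ m.rows,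
        diag := List.replicate us.length Set.univ ++ m.diag,
        buf := (us.flatMap fun u => vs.map fun v => entryRel H (L u) (e u v)).reverse ++ m.buf,
        fuel := List.replicate (k * (us.length * (vs.length + 1))) ∅ ++ m.fuel }.get) := by
  induction us generalizing m r with
  | nil => exact (forEach_nil rfl).cast (by simp) (by simp [reset])
  | cons u us ih =>
    have h1 := ih { m with
      rows := ∅ :: m.rows, diag := Set.univ :: m.diag
      buf := (vs.map fun v => entryRel H (L u) (e u v)).reverse ++ m.buf
      fuel := List.replicate (k * vs.length) ∅ ++ (List.replicate k ∅ ++ m.fuel) }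
      { reset with list := L u }
    have h2 := readInput_entries H k (L u) (vs.map (e u))
      (us.flatMap fun u => Sum.inl (L u) :: vs.map fun v => Sum.inr (e u v))
      { m with
        rows := ∅ :: m.rows, diag := Set.univ :: m.diag
        fuel := List.replicate k ∅ ++ m.fuel } _ _ (by simpa [Function.comp_def] using! h1)
    refine (forEach_cons rfl (act_runs ?_) h2).cast ?_ ?_
    · simp only [List.append_eq, update_inp, runOps_append, runOps_replicate_fuel]
      simp [runOps, Op.run, Mem.get, Function.comp_def, List.flatMap_def]
    · simp only [List.length_cons, List.length_map]
      ring_nf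
      omega
    · have hk : k * ((us.length + 1) * (vs.length + 1)) =
          k * (us.length * (vs.length + 1)) + (k * vs.length + k) := by ring
      simp only [List.length_cons, hk, List.replicate_add _ _ (∅ : PairRel W), List.flatMap_cons,
        List.reverse_append, List.append_assoc, List.replicate_succ', List.singleton_append,
        List.replicate_zero, List.nil_append]

/-- The diagonal relation. -/
def diagRel : PairRel W := {p | p.1 = p.2}

/-- Replaces the first symbol of `diag` by the diagonal relation. -/
def markDiag : Program W :=
  .act [.pop (.work .diag) fun r o => { r with hdr := o.isSome },
    .when Reg.hdr (.push (.work .diag) fun _ => diagRel), .load fun _ => reset]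

/-- Moves one row of the matrix from `buf` to `mat`, intersecting it with the entries of `diag`. -/
def diagRow : Program W :=
  forEach (.work .diag) (fun r a => { r with x := a }) (fun _ => reset)
    (.act [.pop (.work .buf) fun r o => { r with y := o.getD ∅ },
      .push (.work .mat) fun r => r.y ∩ r.x, .push (.work .diagBuf) Reg.x])

theorem diagRow_runs {ι : Type} (l : List ι) (M δ : ι → PairRel W) (rest : List (PairRel W))
    (m : Mem W) (r : Reg W) :
    RunsIn diagRow (r, { m with buf := l.map M ++ rest, diag := l.map δ }.get) (2 * l.length + 1)
      (reset, { m with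
        buf := rest, diag := [], mat := (l.map fun v => M v ∩ δ v).reverse ++ m.mat,
        diagBuf := (l.map δ).reverse ++ m.diagBuf }.get) := by
  induction l generalizing m r with
  | nil => exact (forEach_nil rfl).cast (by simp) rfl
  | cons a l ih =>
    refine (forEach_cons rfl (act_runs ?_) (ih { m with
      mat := (M a ∩ δ a) :: m.mat, diagBuf := δ a :: m.diagBuf }
      { r with x := δ a, y := M a, more := true })).cast
      (by simp only [List.length_cons]; omega) (by simp)
    simp [runOps, Op.run, Mem.get]

/-- Moves the matrix from `buf` to `mat` and intersects its diagonal entries with the diagonal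
relation. After each row the mark on `diag` is shifted by one position. -/
def diagRows : Program W :=
  forEach (.work .rows) (fun r _ => r) (fun _ => reset)
    (.seq diagRow (.seq (.act [.pop (.work .diagBuf) fun _ _ => reset])
      (.seq (move .diagBuf .diag) (.act [.push (.work .diag) fun _ => Set.univ]))))

open Classical in
/-- The entries of `diag` when the row `o` is processed next, or when no row is left. -/
noncomputable def mark {ι : Type} (o : Option ι) (v : ι) : PairRel W :=
  if o = some v then diagRel else Set.univ

theorem map_mark {ι : Type} (pre post : List ι) (u : ι) (h : (pre ++ u :: post).Nodup) :
    (pre ++ u :: post).map (mark (W := W) (some u)) =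
      List.replicate pre.length Set.univ ++ diagRel :: List.replicate post.length Set.univ := by
  rw [List.nodup_middle, List.nodup_cons, List.mem_append, not_or] at h
  have key : ∀ l : List ι, u ∉ l →
      l.map (mark (W := W) (some u)) = List.replicate l.length Set.univ := fun l hl => by
    rw [← List.map_const']
    refine List.map_congr_left fun v hv => if_neg fun huv => hl ?_
    exact Option.some.inj huv ▸ hv
  rw [List.map_append, List.map_cons, key _ h.1.1, key _ h.1.2, mark, if_pos rfl]

theorem map_mark_none {ι : Type} (l : List ι) :
    l.map (mark (W := W) none) = List.replicate l.length Set.univ := by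
  rw [← List.map_const']
  exact List.map_congr_left fun v _ => if_neg (by simp)

/-- Deleting the last mark and adding a neutral one in front shifts the diagonal mark. -/
theorem cons_dropLast_map_mark {ι : Type} (pre post : List ι) (u : ι)
    (h : (pre ++ u :: post).Nodup) :
    Set.univ :: ((pre ++ u :: post).map (mark (W := W) (some u))).dropLast =
      (pre ++ u :: post).map (mark post.head?) := by
  rw [map_mark pre post u h]
  cases post with
  | nil =>
    rw [List.head?_nil, map_mark_none, List.length_append, List.length_singleton,
      List.length_nil, List.replicate_zero, List.dropLast_concat, List.replicate_succ]
  | cons u' post =>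
    have e : pre ++ u :: u' :: post = (pre ++ [u]) ++ u' :: post := by simp
    rw [List.head?_cons, e, map_mark _ _ _ (e ▸ h), List.length_cons, List.replicate_succ',
      ← List.cons_append, ← List.append_assoc, List.dropLast_concat, List.length_append,
      List.length_singleton, List.replicate_succ, List.cons_append]

theorem diagRows_runs {ι : Type} (l pre us : List ι) (hl : l = pre ++ us) (h : l.Nodup)
    (M : ι → ι → PairRel W) (m : Mem W) (r : Reg W) :
    RunsIn diagRows
      (r, { m with
        rows := List.replicate us.length ∅, buf := us.flatMap fun u => l.map (M u),
        diag := l.map (mark us.head?), diagBuf := [] }.get)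
      (us.length * (4 * l.length + 5) + 1)
      (reset, { m with
        rows := [], buf := [], diag := List.replicate l.length Set.univ, diagBuf := [],
        mat := (us.flatMap fun u => l.map fun v => M u v ∩ mark (some u) v).reverse ++
          m.mat }.get) := by
  induction us generalizing pre m r with
  | nil => exact (forEach_nil rfl).cast (by simp) (by simp [map_mark_none, reset])
  | cons u us ih =>
    have h0 := cons_dropLast_map_mark (W := W) pre us u (hl ▸ h)
    rw [← hl] at h0
    have h1 := diagRow_runs l (M u) (mark (some u)) (us.flatMap fun u => l.map (M u))
      { m with rows := List.replicate us.length ∅, diagBuf := [] } { r with more := true }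
    have h2 := move_runs (W := W) (i := .diagBuf) (j := .diag) (by decide) reset { m with
      rows := List.replicate us.length ∅, buf := us.flatMap fun u => l.map (M u), diag := [],
      diagBuf := (l.map (mark (some u))).reverse.tail,
      mat := (l.map fun v => M u v ∩ mark (some u) v).reverse ++ m.mat }.get
    have h3 := ih (pre ++ [u]) (by simp [hl]) { m with
      mat := (l.map fun v => M u v ∩ mark (some u) v).reverse ++ m.mat } reset
    simp only [Mem.get, update_diagBuf, update_diag, List.append_nil, List.tail_reverse,
      List.reverse_reverse] at h2
    simp only [List.append_nil] at h1
    let m' : Mem W := { m with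
      rows := List.replicate us.length ∅, buf := us.flatMap fun u => l.map (M u), diag := [],
      diagBuf := (l.map (mark (some u))).reverse,
      mat := (l.map fun v => M u v ∩ mark (some u) v).reverse ++ m.mat }
    refine (forEach_cons rfl (t := 4 * l.length + 4)
      (RunsIn.mono (.seq (s' := (reset, m'.get)) (t := 2 * l.length + 1) ?_
        (.seq (act_runs ?_) (.seq h2 (act_runs ?_)))) ?_) h3).cast ?_ ?_
    · simpa using! h1
    · simp [runOps, Op.run, Mem.get, m']
    · simp [runOps, Op.run, Mem.get, ← h0]
    · simp only [List.length_reverse, List.length_dropLast, List.length_map]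
      omega
    · simp only [List.length_cons]
      ring_nf
      omega
    · simp

open Classical in
/-- Tests whether all entries of the matrix are non-empty. -/
noncomputable def checkMat : Program W :=
  forEach (.work .mat) (fun r a => { r with ok := r.ok && decide (Set.Nonempty a) })
    (fun r => { reset with ok := r.ok }) (.act [])

open Classical in
theorem checkMat_runs (xs : List (PairRel W)) (m : Mem W) (r : Reg W) :
    RunsIn checkMat (r, { m with mat := xs }.get) (2 * xs.length + 1)
      ({ reset with ok := r.ok && decide (∀ x ∈ xs, Set.Nonempty x) },
        { m with mat := [] }.get) := by
  induction xs generalizing m r with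
  | nil => exact (forEach_nil rfl).cast (by simp) (by simp [reset])
  | cons a l ih =>
    have h1 := ih m { r with ok := r.ok && decide (Set.Nonempty a), more := true }
    refine (forEach_cons rfl (act_runs ?_) h1).cast (by simp only [List.length_cons]; omega) ?_
    · simp [runOps]
    · simp [Bool.and_assoc]

/-- The program that decides the list homomorphism problem by path consistency. -/
noncomputable def main (H : SignedGraph W) (k : ℕ) : Program W :=
  .seq (readInput H k) (.seq markDiag (.seq diagRows (.seq rounds (.seq (clear .diag)
    (.seq checkMat (.act [.push .out Reg.ok, .load fun _ => reset]))))))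

open Classical in
/-- The matrix of constraints as it is produced from the input, which is read in reverse order. -/
theorem word_finRange_constraint (H : SignedGraph W) (I : ListInstance W) :
    word (List.finRange I.n) (I.constraint H) =
      ((List.finRange I.n).reverse.flatMap fun u => (List.finRange I.n).reverse.map fun v =>
        entryRel H (I.list u) (decide (I.graph.pos u v), decide (I.graph.neg u v)) ∩
          mark (some u) v).reverse := by
  rw [← List.reverse_inj, List.reverse_reverse, word, List.reverse_flatMap]
  congr 1
  funext u
  rw [Function.comp_apply, ← List.map_reverse]
  congr 1
  funext v
  simp only [ListInstance.constraint, mark, diagRel, Option.some.injEq]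

open Classical in
/-- The program decides whether all entries of the matrix are non-empty after
`k * (I.n * (I.n + 1))` rounds of path consistency. -/
theorem main_runs (H : SignedGraph W) (k : ℕ) (I : ListInstance W) :
    RunsIn (main H k) (reset, { inp := I.encode : Mem W }.get)
      (2 * (I.n * (I.n + 1)) + 1 + (1 + (I.n * (4 * I.n + 5) + 1 +
        (k * (I.n * (I.n + 1)) * (6 * I.n ^ 3 + 13 * I.n ^ 2 + 6 * I.n + 4) + 1 +
          (2 * I.n + 1 + (2 * (I.n * I.n) + 1 + 1))))))
      (reset, { out := [decide (∀ u v,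
        (refine^[k * (I.n * (I.n + 1))] (I.constraint H) u v).Nonempty)] : Mem W }.get) := by
  have hlen : (List.finRange I.n).length = I.n := List.length_finRange
  have hlen' : (List.finRange I.n).reverse.length = I.n := by simp
  set l := List.finRange I.n with hl
  set N := k * (I.n * (I.n + 1)) with hN
  let e : Fin I.n → Fin I.n → Bool × Bool := fun u v =>
    (decide (I.graph.pos u v), decide (I.graph.neg u v))
  have h1 := readInput_runs H k l l I.list e ({} : Mem W) reset
  have h3 := diagRows_runs l.reverse [] l.reverse rfl
    (List.nodup_reverse.2 (List.nodup_finRange I.n)) (fun u v => entryRel H (I.list u) (e u v))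
    { fuel := List.replicate N ∅ } reset
  have h4 := rounds_runs l List.mem_finRange (I.constraint H) N reset
  have h5 := clear_runs (W := W) .diag reset
    { mat := word l (refine^[N] (I.constraint H)), diag := List.replicate I.n Set.univ : Mem W }.get
  have h6 := checkMat_runs (word l (refine^[N] (I.constraint H))) ({} : Mem W) reset
  have hbuf : (l.flatMap fun u => l.map fun v => entryRel H (I.list u) (e u v)).reverse =
      l.reverse.flatMap fun u => l.reverse.map fun v => entryRel H (I.list u) (e u v) := by
    rw [List.reverse_flatMap]
    congr 1
    funext u
    rw [Function.comp_apply, ← List.map_reverse]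
  have hcon := word_finRange_constraint H I
  have hall : (∀ x ∈ word l (refine^[N] (I.constraint H)), Set.Nonempty x) ↔
      ∀ u v, (refine^[N] (I.constraint H) u v).Nonempty := by
    simp only [word, hl, List.mem_flatMap, List.mem_map, List.mem_finRange, true_and]
    exact ⟨fun h u v => h _ ⟨u, v, rfl⟩, fun h x ⟨u, v, hx⟩ => hx ▸ h u v⟩
  rw [hlen, ← hN, hbuf] at h1
  rw [hlen'] at h3
  rw [hlen] at h4
  rw [length_word, hlen] at h6
  simp only [Mem.get, update_diag, List.length_replicate] at h5
  simp only [List.append_nil, ← hl, e] at h1 h3 hcon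
  rw [← hcon] at h3
  have h2 : ∀ B F : List (PairRel W), RunsIn markDiag
      (reset, { rows := List.replicate I.n ∅, buf := B, fuel := F,
                diag := List.replicate I.n Set.univ : Mem W }.get) 1
      (reset, { rows := List.replicate I.n ∅, buf := B, fuel := F,
                diag := l.reverse.map (mark l.reverse.head?) : Mem W }.get) := by
    intro B F
    have hd : l.reverse.map (mark (W := W) l.reverse.head?) =
        if I.n = 0 then [] else diagRel :: List.replicate (I.n - 1) Set.univ := by
      have hnd : l.reverse.Nodup := List.nodup_reverse.2 (List.nodup_finRange I.n)
      revert hlen' hnd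
      cases l.reverse with
      | nil => intro h _; simp [← h]
      | cons u post =>
        intro h hnd
        rw [List.head?_cons, ← List.nil_append (u :: post), map_mark [] post u hnd]
        have hp : post.length = I.n - 1 := by
          rw [List.length_cons] at h
          omega
        rw [if_neg (by rw [List.length_cons] at h; omega), hp]
        rfl
    rw [hd]
    refine act_runs ?_
    generalize I.n = n
    cases n <;> simp [runOps, Op.run, Mem.get, List.replicate_succ, reset]
  refine h1.seq ((h2 _ _).seq (h3.seq (h4.seq (h5.seq (h6.seq (act_runs ?_))))))
  simp [runOps, Op.run, Mem.get, reset, hall]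

end PathMachine

/-! ### The list homomorphism problem -/

/-- The list homomorphism problem is decided by the machine for path consistency. One unit of fuel
for each pair of values and each symbol of the input is enough for the matrix to become stable. -/
theorem listSHomPolyTime [Fintype W] (H : SignedGraph W) {white : Set W} {lt : W → W → Prop}
    (hirr : H.Irreflexive) (hbal : H.UniBalanced) (hconn : H.uniGraph.Connected)
    (hord : H.IsSpecialBipartiteMinOrdering white lt) : H.ListSHomPolyTime := by
  classical
  let k := Fintype.card ((W × Bool) × (W × Bool))
  let X : Polynomial ℕ := Polynomial.X
  let time : Polynomial ℕ := 2 * X + 1 + (1 + (X * (4 * X + 5) + 1 +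
    (Polynomial.C k * X * (6 * X ^ 3 + 13 * X ^ 2 + 6 * X + 4) + 1 +
      (2 * X + 1 + (2 * (X * X) + 1 + 1)))))
  refine StackProg.Prog.computableInPolyTime (PathMachine.main H k) .inp .out PathMachine.reset
    ListInstance.encode Computability.encodeBool (fun I => decide (I.HasListHom H)) time fun I => ?_
  have hlen : (I.encode).length = I.n * (I.n + 1) := by
    simp [ListInstance.encode, List.length_flatMap]
  have h0 : ∀ k, ({} : PathMachine.Mem W).get k = [] := by
    rintro (_ | _ | _ | _) <;> rfl
  have hin : (Function.update (fun _ => []) .inp I.encode : ∀ k, List (PathMachine.Alphabet W k)) =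
      { inp := I.encode : PathMachine.Mem W }.get := by
    rw [← PathMachine.update_inp {}]
    congr 1
    funext k
    exact (h0 k).symm
  have hout : ∀ b, (Function.update (fun _ => []) .out (Computability.encodeBool b) :
      ∀ k, List (PathMachine.Alphabet W k)) = { out := [b] : PathMachine.Mem W }.get := by
    intro b
    rw [← PathMachine.update_out {}]
    congr 1
    funext k
    exact (h0 k).symm
  -- The number of vertices is bounded by the length of the input.
  have hn : I.n ≤ I.n * (I.n + 1) := Nat.le_mul_of_pos_right _ (Nat.succ_pos _)
  have hdec : decide (I.HasListHom H) = decide (∀ u v,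
      (refine^[k * (I.n * (I.n + 1))] (I.constraint H) u v).Nonempty) := by
    refine decide_eq_decide.2 (I.hasListHom_iff_nonempty hirr hbal hconn hord _ ?_)
    rw [mul_comm]
    exact Nat.mul_le_mul_left _ (Nat.mul_le_mul_left _ (Nat.le_succ _))
  rw [hin, hout, hlen, hdec]
  refine (PathMachine.main_runs H k I).mono ?_
  simp only [time, X, Polynomial.eval_add, Polynomial.eval_mul, Polynomial.eval_pow,
    Polynomial.eval_X, Polynomial.eval_C, Polynomial.eval_one, Polynomial.eval_ofNat]
  gcongr

end SignedGraph

theorem mainTheorem8 {W : Type} [Fintype W] (H : SignedGraph W)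
    (hirr : H.Irreflexive) (hbal : H.UniBalanced) (hconn : H.uniGraph.Connected)
    (hord : ∃ (white : Set W) (lt : W → W → Prop), H.IsSpecialBipartiteMinOrdering white lt) :
    H.ListSHomPolyTime ∧
    ∀ (white : Set W) (lt : W → W → Prop), H.IsSpecialBipartiteMinOrdering white lt →
      ∀ I : SignedGraph.ListInstance W,
        (∀ v, (∀ a ∈ I.list v, a ∈ white) ∨ (∀ a ∈ I.list v, a ∉ white)) →
        (I.HasListHom H ↔
          ∃ f : Fin I.n → W,
            (∀ v, SignedGraph.IsMinimumOf lt (I.arcConsistent H v) (f v)) ∧ I.IsListHom H f) := by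
  obtain ⟨white, lt, h⟩ := hord
  refine ⟨H.listSHomPolyTime hirr hbal hconn h, fun white lt h I hmono => ⟨fun hI => ?_, ?_⟩⟩
  · exact I.exists_minimum_isListHom hirr hbal hconn h hmono hI
  · rintro ⟨f, _, hf⟩
    exact ⟨f, hf⟩
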